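/- For $i\in\mathbb N$ let $W_i\subseteq\mathbb N^2$ be the $i$-th computably enumerable set of pairs (in the standard numbering by programs), and let $E_i$ be the equivalence relation on $\mathbb N$ generated by $W_i$; thus $(E_i)_{i\in\mathbb N}$ is the standard uniform enumeration of the c.e. equivalence relations (ceers). Let $E,F$ be equivalence relations on nonempty computable sets $D,D'$ of natural numbers or of words. We say that $E$ computably reduces to $F$ if there is a computable $f:D\to D'$ such that $x\mathrel{E}y\Leftrightarrow f(x)\mathrel{F}f(y)$ for all $x,y\in D$, and that $E\equiv F$ ($E$ and $F$ are computably equivalent) if each computably reduces to the other. For $S\subseteq\mathbb N$ let $[S]=\{i\mid \exists j\in S\ (E_i\equiv E_j)\}$; $S$ is proper on the infinite ceers if there are $E_i$ and $E_j$, both with infinitely many classes, such that $i\in[S]$ and $j\notin[S]$. A presentation $\langle X\mid R\rangle$ consists of a set $X\subseteq\mathbb N$ of generators and a set $R$ of words over $X\cup X^{-1}$. It is recursive if $X$ and $R$ are computable, finitely generated recursive if moreover $X$ is finite, and finite if $X$ and $R$ are both finite. Its word problem is the equivalence relation on the set of words over $X\cup X^{-1}$ that relates two words when they represent the same element of the group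 $\langle X\mid R\rangle$. A set $A\subseteq\mathbb N$ is $\Sigma^0_3$ if there is a computable relation $Q$ such that $n\in A\Leftrightarrow\exists x\,\forall y\,\exists z\;Q(n,x,y,z)$; it is $\Sigma^0_3$-complete if it is $\Sigma^0_3$ and every $\Sigma^0_3$ set $B\subseteq\mathbb N$ is one-one reducible to it, i.e. there is an injective computable $f:\mathbb N\to\mathbb N$ with $n\in B\Leftrightarrow f(n)\in A$. **Theorem.** Each of the following sets is $\Sigma^0_3$-complete: 1. the set of $i$ such that $E_i$ is computably equivalent to the word problem of a finite group presentation; 2. the set of $i$ such that $E_i$ is computably equivalent to the word problem of a finitely generated recursive group presentation; 3. the set of $i$ such that $E_i$ is computably equivalent to the word problem of a recursive group presentation. Moreover, each of these three sets is of the form $[S]$ for a computably enumerable set $S\subseteq\mathbb N$ that is proper on the infinite ceers. -/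

import Mathlib

/-- The relation on `ℕ` enumerated by the program with index `i`: `x` and `y` are related when
this program halts on the code of the pair `(x, y)`. -/
def enumeratedPairs (i x y : ℕ) : Prop :=
  ((Denumerable.ofNat Nat.Partrec.Code i).eval (Nat.pair x y)).Dom

/-- The `i`-th ceer: the equivalence relation generated by the `i`-th c.e. set of pairs. -/
def ceer (i : ℕ) : Setoid ℕ := Relation.EqvGen.setoid (enumeratedPairs i)

/-- Computable reducibility of the equivalence relation `E` on the set `D` to the equivalence
relation `F` on the set `D'`. The domains below are computable and nonempty, so that asking for
a total computable function on the ambient type is no restriction. -/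
def ComputablyReduces {α β : Type} [Primcodable α] [Primcodable β]
    (D : Set α) (E : α → α → Prop) (D' : Set β) (F : β → β → Prop) : Prop :=
  ∃ f : α → β, Computable f ∧ (∀ x ∈ D, f x ∈ D') ∧
    ∀ x ∈ D, ∀ y ∈ D, (E x y ↔ F (f x) (f y))

/-- Computable equivalence: computable reducibility in both directions. -/
def ComputablyEquivalent {α β : Type} [Primcodable α] [Primcodable β]
    (D : Set α) (E : α → α → Prop) (D' : Set β) (F : β → β → Prop) : Prop :=
  ComputablyReduces D E D' F ∧ ComputablyReduces D' F D E

/-- The set `[S]` of indices of ceers that are computably equivalent to a ceer with index in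
`S`. -/
def ceerClosure (S : Set ℕ) : Set ℕ :=
  {i | ∃ j ∈ S, ComputablyEquivalent Set.univ (ceer i).r Set.univ (ceer j).r}

/-- `[S]` contains some, but not all, of the ceers with infinitely many classes. -/
def ProperOnInfiniteCeers (S : Set ℕ) : Prop :=
  (∃ i, Infinite (Quotient (ceer i)) ∧ i ∈ ceerClosure S) ∧
    ∃ j, Infinite (Quotient (ceer j)) ∧ j ∉ ceerClosure S

/-- `Σ⁰₃` sets of natural numbers. -/
def IsSigmaThree (A : Set ℕ) : Prop :=
  ∃ R : ℕ × ℕ × ℕ × ℕ → Prop, ComputablePred R ∧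
    ∀ n, n ∈ A ↔ ∃ x, ∀ y, ∃ z, R (n, x, y, z)

/-- `Σ⁰₃`-complete sets of natural numbers, with respect to one-one reducibility. -/
def IsSigmaThreeComplete (A : Set ℕ) : Prop :=
  IsSigmaThree A ∧
    ∀ B : Set ℕ, IsSigmaThree B → OneOneReducible (fun n => n ∈ B) (fun n => n ∈ A)

/-- A presentation `⟨X ∣ R⟩` of a group, with a set `X` of natural numbers as generators. A
relator is a word, not necessarily reduced; the letter `(x, true)` is the generator `x` and
`(x, false)` is its inverse. -/
structure GroupPresentation where
  gens : Set ℕ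
  rels : Set (List (gens × Bool))

namespace GroupPresentation

/-- The presented group. -/
abbrev Carrier (P : GroupPresentation) : Type :=
  PresentedGroup (FreeGroup.mk '' P.rels)

/-- The element of the presented group that a word in the generators stands for. -/
def value (P : GroupPresentation) (u : List (P.gens × Bool)) : P.Carrier :=
  PresentedGroup.mk (FreeGroup.mk '' P.rels) (FreeGroup.mk u)

/-- A word in the generators, read as a word over the alphabet of all natural numbers and their
formal inverses. -/
def spell (P : GroupPresentation) (u : List (P.gens × Bool)) : List (ℕ × Bool) :=
  u.map (Prod.map Subtype.val id)

/-- The set of words in the generators and their inverses. -/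
def words (P : GroupPresentation) : Set (List (ℕ × Bool)) := Set.range P.spell

/-- The word problem, an equivalence relation on `P.words`: two words are related when they stand
for the same element of the group. -/
def WordProblem (P : GroupPresentation) (w w' : List (ℕ × Bool)) : Prop :=
  ∃ u v, P.spell u = w ∧ P.spell v = w' ∧ P.value u = P.value v

/-- Recursive presentations: the sets of generators and of relators are computable. -/
def IsRecursive (P : GroupPresentation) : Prop :=
  ComputablePred (fun x => x ∈ P.gens) ∧ ComputablePred (fun w => w ∈ P.spell '' P.rels)

/-- Recursive presentations with finitely many generators. -/
def IsFGRecursive (P : GroupPresentation) : Prop := P.gens.Finite ∧ P.IsRecursive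

/-- Finite presentations. -/
def IsFinite (P : GroupPresentation) : Prop := P.gens.Finite ∧ P.rels.Finite

end GroupPresentation

/-- The set of indices of ceers computably equivalent to the word problem of a presentation with
the property `C`. -/
def wordProblemIndices (C : GroupPresentation → Prop) : Set ℕ :=
  {i | ∃ P, C P ∧ ComputablyEquivalent Set.univ (ceer i).r P.words P.WordProblem}

/-- The set `A` of indices of ceers is `[S]` for a c.e. set `S` that is proper on the infinite
ceers. -/
def IsCEProper (A : Set ℕ) : Prop :=
  ∃ S : Set ℕ, REPred (fun n => n ∈ S) ∧ ProperOnInfiniteCeers S ∧ ceerClosure S = A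

/-!
Three facts give the theorem.

*The sets are closures of c.e. sets.* Whether two words have the same value is a c.e. relation,
uniformly in an enumeration of the relators: a word has value `1` if and only if it is freely
equal to a product of conjugates of relators and their inverses (`ambientValue_range_eq_one_iff`).
Up to equivalence of the word problems, each of the three classes of presentations has a uniform
enumeration `ofEnum`. Indeed a presentation may be enlarged by new generators that are also
relators (`computablyEquivalent_ofEnum`), so that the generators can be taken to be an initial
segment of `ℕ`, or all of `ℕ`; and a c.e. set of relators can be made computable by padding the
relators with trivial factors `x x⁻¹` that record the stage of the enumeration (`enumRelator`).

*The closure `[S]` of a c.e. set `S` is `Σ⁰₃`* (`isSigmaThree_ceerClosure`): that given programs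
are total and reduce one ceer to another is a `Π⁰₂` condition.

*Hardness and properness.* For a c.e. set `A`, let `pairRel A` identify `2 m` with `2 m + 1` for
`m ∈ A`. If `A` is computable, this relation is equivalent to equality on `ℕ`, hence to the word
problem of the infinite cyclic group (`pairRel_equivalent_infiniteCyclic`). Conversely a word
problem is many-one reducible to each of its classes, since `u` and `v` have the same value if and
only if `u v⁻¹` has value `1`. As the classes of `pairRel A` are finite, it is equivalent to a
word problem only if it is computable, that is, only if `A` is
(`computablePred_of_pairRel_equivalent_wordProblem`). Thus computability of c.e. sets reduces to
each of the three index sets, and it is `Σ⁰₃`-hard (`exists_computable_iff_mem_of_isSigmaThree`).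
All ceers `pairRel A` have infinitely many classes, which also gives properness.
-/

open Nat.Partrec (Code)
open Nat.Partrec.Code (evaln eval)
open Encodable Denumerable

/-! ### Programs run for a bounded number of steps -/

/-- The program `c` halts on the input `a` within `s` steps, in the sense of `evaln`, which also
requires the inputs to be less than `s`. -/
def haltsWithin (c : Code) (s a : ℕ) : Bool := (evaln s c a).isSome

theorem primrec_haltsWithin : Primrec fun t : Code × ℕ × ℕ => haltsWithin t.1 t.2.1 t.2.2 :=
  Primrec.option_isSome.comp <| Nat.Partrec.Code.primrec_evaln.comp <|
    Primrec.pair (Primrec.pair (Primrec.fst.comp Primrec.snd) Primrec.fst)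
      (Primrec.snd.comp Primrec.snd)

theorem haltsWithin_mono {c : Code} {s s' a : ℕ} (h : s ≤ s') (ha : haltsWithin c s a) :
    haltsWithin c s' a := by
  obtain ⟨b, hb⟩ := Option.isSome_iff_exists.1 ha
  exact Option.isSome_iff_exists.2 ⟨b, Nat.Partrec.Code.evaln_mono h hb⟩

theorem eval_dom_iff_haltsWithin {c : Code} {a : ℕ} :
    (eval c a).Dom ↔ ∃ s, haltsWithin c s a := by
  simp only [Part.dom_iff_mem, Nat.Partrec.Code.evaln_complete, haltsWithin,
    Option.isSome_iff_exists, Option.mem_def]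
  exact exists_comm

theorem REPred.exists_code {α : Type*} [Primcodable α] {p : α → Prop} (hp : REPred p) :
    ∃ c : Code, ∀ a, p a ↔ ∃ s, haltsWithin c s (encode a) := by
  obtain ⟨c, hc⟩ := Nat.Partrec.Code.exists_code.1 hp
  refine ⟨c, fun a => ?_⟩
  rw [← eval_dom_iff_haltsWithin, hc]
  simp [Part.assert]

theorem REPred.of_exists {α γ : Type*} [Primcodable α] [Primcodable γ] {R : α × γ → Prop}
    (hR : ComputablePred R) : REPred fun a => ∃ z, R (a, z) := by
  obtain ⟨f, hf, rfl⟩ := ComputablePred.computable_iff.1 hR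
  have h : Computable₂ fun (a : α) (n : ℕ) =>
      (decode (α := γ) n).bind fun z => bif f (a, z) then some () else none := by
    refine Computable.option_bind (Computable.decode.comp Computable.snd) ?_
    exact Computable.cond (hf.comp ((Computable.fst.comp Computable.fst).pair Computable.snd))
      (Computable.const _) (Computable.const _)
  refine (Partrec.rfindOpt h).dom_re.of_eq fun a => ?_
  rw [Nat.rfindOpt_dom]
  constructor
  · rintro ⟨n, u, hu⟩
    obtain ⟨z, -, hz⟩ := Option.bind_eq_some_iff.1 hu
    refine ⟨z, ?_⟩
    by_contra hne
    simp [Bool.eq_false_iff.2 hne] at hz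
  · rintro ⟨z, hz⟩
    exact ⟨encode z, (), by simp [encodek, hz]⟩

theorem isSigmaThree_of_denumerable {α β γ : Type} [Denumerable α] [Denumerable β] [Denumerable γ]
    {A : Set ℕ} {R : ℕ × α × β × γ → Prop} (hR : ComputablePred R)
    (h : ∀ n, n ∈ A ↔ ∃ x, ∀ y, ∃ z, R (n, x, y, z)) : IsSigmaThree A := by
  have hf : Computable fun t : ℕ × ℕ × ℕ × ℕ =>
      (t.1, ofNat α t.2.1, ofNat β t.2.2.1, ofNat γ t.2.2.2) :=
    Primrec.to_comp <| Primrec.fst.pair <|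
      ((Primrec.ofNat α).comp (Primrec.fst.comp Primrec.snd)).pair <|
      ((Primrec.ofNat β).comp (Primrec.fst.comp (Primrec.snd.comp Primrec.snd))).pair <|
      (Primrec.ofNat γ).comp (Primrec.snd.comp (Primrec.snd.comp Primrec.snd))
  obtain ⟨f, hfR, rfl⟩ := ComputablePred.computable_iff.1 hR
  refine ⟨_, ComputablePred.computable_iff.2 ⟨_, hfR.comp hf, rfl⟩, fun n => ?_⟩
  rw [h n]
  constructor
  · rintro ⟨x, hx⟩
    refine ⟨encode x, fun y => ?_⟩
    obtain ⟨z, hz⟩ := hx (ofNat β y)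
    exact ⟨encode z, by simpa using hz⟩
  · rintro ⟨x, hx⟩
    refine ⟨ofNat α x, fun y => ?_⟩
    obtain ⟨z, hz⟩ := hx (encode y)
    exact ⟨ofNat γ z, by simpa using hz⟩

/-! ### Ceers -/

/-- One step from `x` towards `p.2`, taken if the program with index `i` is seen, within `p.1`
steps, to enumerate one of the pairs `(x, p.2)` and `(p.2, x)`. -/
def hop (i x : ℕ) (p : ℕ × ℕ) : ℕ :=
  bif haltsWithin (ofNat Code i) p.1 (Nat.pair x p.2) ||
      haltsWithin (ofNat Code i) p.1 (Nat.pair p.2 x) then p.2 else x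

/-- The end of the walk from `x` along the list `L` of attempted steps. -/
def walk (i x : ℕ) (L : List (ℕ × ℕ)) : ℕ := L.foldl (hop i) x

theorem primrec_walk : Primrec fun t : ℕ × ℕ × List (ℕ × ℕ) => walk t.1 t.2.1 t.2.2 := by
  have hhop : Primrec fun t : ℕ × ℕ × ℕ × ℕ => hop t.1 t.2.1 t.2.2 := by
    have hc : Primrec fun t : ℕ × ℕ × ℕ × ℕ => ofNat Code t.1 :=
      (Primrec.ofNat Code).comp Primrec.fst
    have hs : Primrec fun t : ℕ × ℕ × ℕ × ℕ => t.2.2.1 :=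
      Primrec.fst.comp (Primrec.snd.comp Primrec.snd)
    have hx : Primrec fun t : ℕ × ℕ × ℕ × ℕ => t.2.1 := Primrec.fst.comp Primrec.snd
    have hy : Primrec fun t : ℕ × ℕ × ℕ × ℕ => t.2.2.2 :=
      Primrec.snd.comp (Primrec.snd.comp Primrec.snd)
    exact Primrec.cond (Primrec.or.comp
      (primrec_haltsWithin.comp (hc.pair (hs.pair (Primrec₂.natPair.comp hx hy))))
      (primrec_haltsWithin.comp (hc.pair (hs.pair (Primrec₂.natPair.comp hy hx))))) hy hx
  exact Primrec.list_foldl (Primrec.snd.comp Primrec.snd) (Primrec.fst.comp Primrec.snd)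
    (hhop.comp ((Primrec.fst.comp Primrec.fst).pair Primrec.snd)).to₂

theorem ceer_iff_exists_walk {i x y : ℕ} : (ceer i).r x y ↔ ∃ L, walk i x L = y := by
  constructor
  · intro h
    change Relation.EqvGen (enumeratedPairs i) x y at h
    induction h with
    | rel x y h =>
      obtain ⟨s, hs⟩ := eval_dom_iff_haltsWithin.1 h
      exact ⟨[(s, y)], by simp [walk, hop, hs]⟩
    | refl x => exact ⟨[], rfl⟩
    | symm x y _ ih =>
      obtain ⟨L, rfl⟩ := ih
      clear * -
      induction L generalizing x with
      | nil => exact ⟨[], rfl⟩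
      | cons p L ih =>
        obtain ⟨L', h'⟩ := ih (hop i x p)
        refine ⟨L' ++ [(p.1, x)], ?_⟩
        rw [walk, List.foldl_append]
        change hop i (walk i (walk i (hop i x p) L) L') (p.1, x) = x
        rw [h']
        simp only [hop]
        cases h : haltsWithin (ofNat Code i) p.1 (Nat.pair x p.2) ||
          haltsWithin (ofNat Code i) p.1 (Nat.pair p.2 x)
        · simp
        · rw [cond_true, Bool.or_comm, h, cond_true]
    | trans x y z _ _ ih₁ ih₂ =>
      obtain ⟨L, rfl⟩ := ih₁
      obtain ⟨L', rfl⟩ := ih₂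
      exact ⟨L ++ L', by simp [walk]⟩
  · rintro ⟨L, rfl⟩
    induction L generalizing x with
    | nil => exact (ceer i).refl x
    | cons p L ih =>
      refine (ceer i).trans (b := hop i x p) ?_ ih
      change Relation.EqvGen _ _ _
      unfold hop
      cases h : haltsWithin (ofNat Code i) p.1 (Nat.pair x p.2) ||
          haltsWithin (ofNat Code i) p.1 (Nat.pair p.2 x)
      · exact .refl _
      · rcases Bool.or_eq_true_iff.1 h with h | h
        · exact .rel _ _ (eval_dom_iff_haltsWithin.2 ⟨_, h⟩)
        · exact .symm _ _ (.rel _ _ (eval_dom_iff_haltsWithin.2 ⟨_, h⟩))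

/-- Uniformly c.e. equivalence relations have ceer indices that are computable, and can be chosen
injective, in the parameter. -/
theorem exists_ceer_index {α : Type*} [Primcodable α] {Q : α → ℕ → ℕ → Prop}
    (hQ : REPred fun t : α × ℕ × ℕ => Q t.1 t.2.1 t.2.2) (hE : ∀ a, Equivalence (Q a)) :
    ∃ j : α → ℕ, Computable j ∧ Function.Injective j ∧ ∀ a, (ceer (j a)).r = Q a := by
  obtain ⟨c, hc⟩ := hQ.exists_code
  refine ⟨fun a => encode (Nat.Partrec.Code.curry c (encode a)), ?_, ?_, fun a => ?_⟩
  · exact (Primrec.encode.comp (Nat.Partrec.Code.primrec₂_curry.comp (Primrec.const c)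
      Primrec.encode)).to_comp
  · intro a b h
    exact encode_injective (Nat.Partrec.Code.curry_inj (encode_injective h)).2
  · have h : enumeratedPairs (encode (Nat.Partrec.Code.curry c (encode a))) = Q a := by
      funext x y
      rw [enumeratedPairs, ofNat_encode, Nat.Partrec.Code.eval_curry, eval_dom_iff_haltsWithin,
        eq_iff_iff, hc (a, x, y)]
      rfl
    change Relation.EqvGen _ = _
    rw [h, (hE a).eqvGen_eq]

/-! ### Closures of c.e. sets of indices -/

/-- Computable reductions between ceers, expressed by the program for the reducing function. -/
theorem computablyReduces_ceer_iff {i j : ℕ} :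
    ComputablyReduces Set.univ (ceer i).r Set.univ (ceer j).r ↔
      ∃ e : Code, ∀ x y, ∃ u ∈ eval e x, ∃ v ∈ eval e y, ((ceer i).r x y ↔ (ceer j).r u v) := by
  constructor
  · rintro ⟨f, hf, -, hE⟩
    obtain ⟨e, he⟩ := Nat.Partrec.Code.exists_code.1 (Partrec.nat_iff.1 hf)
    exact ⟨e, fun x y => ⟨f x, by simp [he], f y, by simp [he], hE x trivial y trivial⟩⟩
  · rintro ⟨e, he⟩
    choose f hf using fun x => (he x x).imp fun u hu => hu.1
    refine ⟨f, ?_, fun _ _ => trivial, fun x _ y _ => ?_⟩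
    · exact (Partrec.nat_iff.2 (Nat.Partrec.Code.exists_code.2 ⟨e, rfl⟩)).of_eq fun x =>
        Part.eq_some_iff.2 (hf x)
    · obtain ⟨u, hu, v, hv, h⟩ := he x y
      rwa [Part.mem_unique (hf x) hu, Part.mem_unique (hf y) hv]

/-- The finite part of the condition that the program `e` reduces the ceer `i` to the ceer `j`,
where `t = (i, j, e)`. The pair `y.1`, `y.2.1` of inputs has the outputs `z.2.1` and `z.2.2.1`, and
if the walk `y.2.2` connects the inputs or the outputs, then one of the walks `z.2.2.2` connects the
other pair. -/
def ReducesAt (t : ℕ × ℕ × Code) (y : ℕ × ℕ × List (ℕ × ℕ))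
    (z : ℕ × ℕ × ℕ × List (ℕ × ℕ) × List (ℕ × ℕ)) : Prop :=
  evaln z.1 t.2.2 y.1 = some z.2.1 ∧ evaln z.1 t.2.2 y.2.1 = some z.2.2.1 ∧
    (¬ walk t.1 y.1 y.2.2 = y.2.1 ∨ walk t.2.1 z.2.1 z.2.2.2.1 = z.2.2.1) ∧
    (¬ walk t.2.1 z.2.1 y.2.2 = z.2.2.1 ∨ walk t.1 y.1 z.2.2.2.2 = y.2.1)

theorem primrecPred_reducesAt {α : Type*} [Primcodable α] {t : α → ℕ × ℕ × Code}
    {y : α → ℕ × ℕ × List (ℕ × ℕ)} {z : α → ℕ × ℕ × ℕ × List (ℕ × ℕ) × List (ℕ × ℕ)}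
    (ht : Primrec t) (hy : Primrec y) (hz : Primrec z) :
    PrimrecPred fun a => ReducesAt (t a) (y a) (z a) := by
  have hi := Primrec.fst.comp ht
  have hj := Primrec.fst.comp (Primrec.snd.comp ht)
  have he := Primrec.snd.comp (Primrec.snd.comp ht)
  have ha := Primrec.fst.comp hy
  have hb := Primrec.fst.comp (Primrec.snd.comp hy)
  have hL := Primrec.snd.comp (Primrec.snd.comp hy)
  have hs := Primrec.fst.comp hz
  have hz₁ := Primrec.snd.comp hz
  have hu := Primrec.fst.comp hz₁
  have hz₂ := Primrec.snd.comp hz₁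
  have hv := Primrec.fst.comp hz₂
  have hL₁ := Primrec.fst.comp (Primrec.snd.comp hz₂)
  have hL₂ := Primrec.snd.comp (Primrec.snd.comp hz₂)
  have hev {x : α → ℕ} (hx : Primrec x) : Primrec fun a => evaln (z a).1 (t a).2.2 (x a) :=
    Nat.Partrec.Code.primrec_evaln.comp ((hs.pair he).pair hx)
  have hw {i x y : α → ℕ} {L : α → List (ℕ × ℕ)} (hi : Primrec i) (hx : Primrec x)
      (hL : Primrec L) (hy : Primrec y) : PrimrecPred fun a => walk (i a) (x a) (L a) = y a :=
    Primrec.eq.comp (primrec_walk.comp (hi.pair (hx.pair hL))) hy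
  exact (Primrec.eq.comp (hev ha) (Primrec.option_some.comp hu)).and <|
    (Primrec.eq.comp (hev hb) (Primrec.option_some.comp hv)).and <|
    ((hw hi ha hL hb).not.or (hw hj hu hL₁ hv)).and
      ((hw hj hu hL hv).not.or (hw hi ha hL₂ hb))

/-- That a given program reduces one ceer to another is a `Π⁰₂` condition, as `ReducesAt` is
decidable. -/
theorem computablyReduces_ceer_iff_reducesAt {i j : ℕ} :
    ComputablyReduces Set.univ (ceer i).r Set.univ (ceer j).r ↔
      ∃ e : Code, ∀ y, ∃ z, ReducesAt (i, j, e) y z := by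
  rw [computablyReduces_ceer_iff]
  refine exists_congr fun e => ⟨?_, ?_⟩
  · rintro h ⟨a, b, L⟩
    obtain ⟨u, hu, v, hv, hE⟩ := h a b
    obtain ⟨s, hs⟩ := Nat.Partrec.Code.evaln_complete.1 hu
    obtain ⟨s', hs'⟩ := Nat.Partrec.Code.evaln_complete.1 hv
    rw [ceer_iff_exists_walk, ceer_iff_exists_walk] at hE
    obtain ⟨L₁, h₁⟩ : ∃ L₁, ¬ walk i a L = b ∨ walk j u L₁ = v := by
      by_cases hL : walk i a L = b
      · exact (hE.1 ⟨L, hL⟩).imp fun _ => Or.inr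
      · exact ⟨[], .inl hL⟩
    obtain ⟨L₂, h₂⟩ : ∃ L₂, ¬ walk j u L = v ∨ walk i a L₂ = b := by
      by_cases hL : walk j u L = v
      · exact (hE.2 ⟨L, hL⟩).imp fun _ => Or.inr
      · exact ⟨[], .inl hL⟩
    exact ⟨(max s s', u, v, L₁, L₂), Nat.Partrec.Code.evaln_mono (le_max_left _ _) hs,
      Nat.Partrec.Code.evaln_mono (le_max_right _ _) hs', h₁, h₂⟩
  · intro h a b
    obtain ⟨⟨s, u, v, _, _⟩, hu, hv, _, _⟩ := h (a, b, [])
    have hu := Nat.Partrec.Code.evaln_sound hu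
    have hv := Nat.Partrec.Code.evaln_sound hv
    refine ⟨u, hu, v, hv, ?_⟩
    simp only [ceer_iff_exists_walk]
    constructor
    all_goals
      rintro ⟨L, hL⟩
      obtain ⟨⟨s, u', v', L₁, L₂⟩, hu', hv', h₁, h₂⟩ := h (a, b, L)
      obtain rfl : u' = u := Part.mem_unique (Nat.Partrec.Code.evaln_sound hu') hu
      obtain rfl : v' = v := Part.mem_unique (Nat.Partrec.Code.evaln_sound hv') hv
    · exact ⟨L₁, h₁.resolve_left (not_not_intro hL)⟩
    · exact ⟨L₂, h₂.resolve_left (not_not_intro hL)⟩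

theorem isSigmaThree_ceerClosure {S : Set ℕ} (hS : REPred fun n => n ∈ S) :
    IsSigmaThree (ceerClosure S) := by
  obtain ⟨c, hc⟩ := hS.exists_code
  refine isSigmaThree_of_denumerable (α := ℕ × Code × Code) (β := ℕ × ℕ × List (ℕ × ℕ))
    (γ := ℕ × (ℕ × ℕ × ℕ × List (ℕ × ℕ) × List (ℕ × ℕ)) × ℕ × ℕ × ℕ × List (ℕ × ℕ) × List (ℕ × ℕ))
    (R := fun t => haltsWithin c t.2.2.2.1 t.2.1.1 ∧
      ReducesAt (t.1, t.2.1.1, t.2.1.2.1) t.2.2.1 t.2.2.2.2.1 ∧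
      ReducesAt (t.2.1.1, t.1, t.2.1.2.2) t.2.2.1 t.2.2.2.2.2) ?_ fun n => ?_
  · have hx := Primrec.fst.comp (Primrec.snd (α := ℕ) (β := (ℕ × Code × Code) ×
      (ℕ × ℕ × List (ℕ × ℕ)) × ℕ × (ℕ × ℕ × ℕ × List (ℕ × ℕ) × List (ℕ × ℕ)) ×
        ℕ × ℕ × ℕ × List (ℕ × ℕ) × List (ℕ × ℕ)))
    have hyz := Primrec.snd.comp (Primrec.snd (α := ℕ) (β := (ℕ × Code × Code) ×
      (ℕ × ℕ × List (ℕ × ℕ)) × ℕ × (ℕ × ℕ × ℕ × List (ℕ × ℕ) × List (ℕ × ℕ)) ×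
        ℕ × ℕ × ℕ × List (ℕ × ℕ) × List (ℕ × ℕ)))
    have hy := Primrec.fst.comp hyz
    have hz := Primrec.snd.comp hyz
    have hj := Primrec.fst.comp hx
    have hs := Primrec.fst.comp hz
    exact PrimrecPred.computablePred <|
      (Primrec.eq.comp (primrec_haltsWithin.comp ((Primrec.const c).pair (hs.pair hj)))
        (Primrec.const true)).and <|
      (primrecPred_reducesAt
        (Primrec.fst.pair (hj.pair (Primrec.fst.comp (Primrec.snd.comp hx)))) hy
        (Primrec.fst.comp (Primrec.snd.comp hz))).and <|
      primrecPred_reducesAt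
        (hj.pair (Primrec.fst.pair (Primrec.snd.comp (Primrec.snd.comp hx)))) hy
        (Primrec.snd.comp (Primrec.snd.comp hz))
  · simp only [ceerClosure, Set.mem_ofPred_eq, ComputablyEquivalent,
      computablyReduces_ceer_iff_reducesAt]
    constructor
    · rintro ⟨j, hj, ⟨e, he⟩, e', he'⟩
      obtain ⟨s, hs⟩ := (hc j).1 hj
      refine ⟨(j, e, e'), fun y => ?_⟩
      obtain ⟨z, hz⟩ := he y
      obtain ⟨z', hz'⟩ := he' y
      exact ⟨(s, z, z'), hs, hz, hz'⟩
    · rintro ⟨⟨j, e, e'⟩, h⟩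
      refine ⟨j, (hc j).2 ?_, ⟨e, fun y => ?_⟩, e', fun y => ?_⟩
      · obtain ⟨z, hz, -⟩ := h (0, 0, [])
        exact ⟨_, hz⟩
      · obtain ⟨z, -, hz, -⟩ := h y
        exact ⟨_, hz⟩
      · obtain ⟨z, -, -, hz⟩ := h y
        exact ⟨_, hz⟩

/-! ### The index set of the computable sets is `Σ⁰₃`-hard -/

/-- A relation all of whose rows are initial segments of `ℕ`, and all but finitely many of them
equal to `ℕ`, is computable: finitely many lengths describe it. -/
theorem computablePred_of_initial_segments {p : ℕ → ℕ → Prop} {e₀ : ℕ}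
    (hp : ∀ e k k', k ≤ k' → p e k' → p e k) (h₀ : ∀ e k, e₀ ≤ e → p e k) :
    ComputablePred fun m : ℕ => p m.unpair.1 m.unpair.2 := by
  classical
  -- The entry `0` stands for a full row, and `b + 1` for the row `{k | k < b}`.
  have hb : ∀ e, ∃ b, ∀ k, p e k ↔ b = 0 ∨ k + 1 < b := fun e => by
    by_cases h : ∃ k, ¬ p e k
    · refine ⟨Nat.find h + 1, fun k => ?_⟩
      have : p e k ↔ k < Nat.find h :=
        ⟨fun hk => lt_of_not_ge fun hle => Nat.find_spec h (hp _ _ _ hle hk),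
          fun hk => not_not.1 (Nat.find_min h hk)⟩
      rw [this]
      omega
    · push Not at h
      exact ⟨0, fun k => by simp [h k]⟩
  choose b hb using hb
  have hl : ∀ e k, p e k ↔ ((List.range e₀).map b).getD e 0 = 0 ∨
      k + 1 < ((List.range e₀).map b).getD e 0 := fun e k => by
    by_cases he : e < e₀
    · simpa [List.getD_eq_getElem?_getD, List.getElem?_range he] using hb e k
    · have he := not_lt.1 he
      simp [List.getD_eq_getElem?_getD, he, h₀ e k he]
  have he : Primrec fun m : ℕ => ((List.range e₀).map b).getD m.unpair.1 0 :=
    (Primrec.list_getD 0).comp (Primrec.const _) (Primrec.fst.comp Primrec.unpair)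
  exact ((Primrec.eq.comp he (Primrec.const 0)).or (Primrec.nat_lt.comp
    (Primrec.succ.comp (Primrec.snd.comp Primrec.unpair)) he)).computablePred.of_eq
    fun m => (hl _ _).symm

/-- The computable sets form a `Σ⁰₃`-hard class of c.e. sets. Write `n ∈ B` as `∃ x, ∀ y, ∃ z, R
(n, x, y, z)`, and call the least `y` without a `z` the progress of `x`. The row `e` of `A n`
contains the initial segment whose length is the largest progress of some `x ≤ e`, and it is full
when the `e`-th program halts. An `x` with infinite progress fills almost all rows; without one,
the gaps in the rows decide the halting problem. -/
theorem exists_computable_iff_mem_of_isSigmaThree {B : Set ℕ} (hB : IsSigmaThree B) :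
    ∃ A : ℕ → Set ℕ, (REPred fun t : ℕ × ℕ => t.2 ∈ A t.1) ∧
      ∀ n, n ∈ B ↔ ComputablePred fun m => m ∈ A n := by
  obtain ⟨R, hR, hBR⟩ := hB
  obtain ⟨f, hf, rfl⟩ := ComputablePred.computable_iff.1 hR
  have hRE : REPred fun t : ℕ × ℕ × ℕ => ∃ z, f (t.1, t.2.1, t.2.2, z) :=
    REPred.of_exists (R := fun t : (ℕ × ℕ × ℕ) × ℕ => f (t.1.1, t.1.2.1, t.1.2.2, t.2)) <|
      ComputablePred.computable_iff.2 ⟨_, hf.comp <| Primrec.to_comp <|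
        (Primrec.fst.comp Primrec.fst).pair <|
        (Primrec.fst.comp (Primrec.snd.comp Primrec.fst)).pair <|
        (Primrec.snd.comp (Primrec.snd.comp Primrec.fst)).pair Primrec.snd, rfl⟩
  obtain ⟨c, hc⟩ := hRE.exists_code
  let p (n e k : ℕ) : Prop := ∃ x ∈ List.range (e + 1), ∀ y ∈ List.range k,
    ∃ s, haltsWithin c s (encode (n, x, y))
  let K (e : ℕ) : Prop := (eval (ofNat Code e) 0).Dom
  have hp : ∀ n e k k', k ≤ k' → p n e k' → p n e k := fun n e k k' hk ⟨x, hx, h⟩ =>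
    ⟨x, hx, fun y hy => h y (List.mem_range.2 ((List.mem_range.1 hy).trans_le hk))⟩
  refine ⟨fun n => {m | p n m.unpair.1 m.unpair.2 ∨ K m.unpair.1}, ?_, fun n => ?_⟩
  · have h₁ : PrimrecRel fun (y : ℕ) (t : ℕ × ℕ × ℕ) =>
        haltsWithin c t.2.2 (encode (t.1, t.2.1, y)) := by
      refine Primrec.eq.comp (primrec_haltsWithin.comp (Primrec.pair (Primrec.const c)
        (Primrec.pair ?_ (Primrec.encode.comp (Primrec.pair ?_ (Primrec.pair ?_ ?_))))))
        (Primrec.const true)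
      · exact Primrec.snd.comp (Primrec.snd.comp Primrec.snd)
      · exact Primrec.fst.comp Primrec.snd
      · exact Primrec.fst.comp (Primrec.snd.comp Primrec.snd)
      · exact Primrec.fst
    have h₂ : PrimrecRel fun (x : ℕ) (t : ℕ × ℕ × ℕ) =>
        ∀ y ∈ List.range t.2.1, haltsWithin c t.2.2 (encode (t.1, x, y)) :=
      h₁.forall_mem_list.comp
        (Primrec.list_range.comp (Primrec.fst.comp (Primrec.snd.comp Primrec.snd)))
        (Primrec.pair (Primrec.fst.comp Primrec.snd) (Primrec.pair Primrec.fst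
          (Primrec.snd.comp (Primrec.snd.comp Primrec.snd))))
    have hm : Primrec fun t : (ℕ × ℕ) × ℕ => t.1.2.unpair :=
      Primrec.unpair.comp (Primrec.snd.comp Primrec.fst)
    have h₃ : PrimrecPred fun t : (ℕ × ℕ) × ℕ => ∃ x ∈ List.range (t.1.2.unpair.1 + 1),
        ∀ y ∈ List.range t.1.2.unpair.2, haltsWithin c t.2 (encode (t.1.1, x, y)) :=
      h₂.exists_mem_list.comp
        (Primrec.list_range.comp (Primrec.succ.comp (Primrec.fst.comp hm)))
        (Primrec.pair (Primrec.fst.comp Primrec.fst) (Primrec.pair (Primrec.snd.comp hm)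
          Primrec.snd))
    have h₄ : PrimrecPred fun t : (ℕ × ℕ) × ℕ =>
        haltsWithin (ofNat Code t.1.2.unpair.1) t.2 0 :=
      Primrec.eq.comp (primrec_haltsWithin.comp (((Primrec.ofNat Code).comp
        (Primrec.fst.comp hm)).pair (Primrec.snd.pair (Primrec.const 0)))) (Primrec.const true)
    refine (REPred.of_exists (h₃.or h₄).computablePred).of_eq fun t => ?_
    simp only [exists_or, Set.mem_ofPred_eq, K, eval_dom_iff_haltsWithin, p]
    refine or_congr_left ⟨?_, ?_⟩
    · rintro ⟨s, x, hx, h⟩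
      exact ⟨x, hx, fun y hy => ⟨s, h y hy⟩⟩
    · rintro ⟨x, hx, h⟩
      choose! s hs using h
      exact ⟨((List.range t.2.unpair.2).map s).sum, x, hx, fun y hy =>
        haltsWithin_mono (List.le_sum_of_mem (List.mem_map_of_mem hy)) (hs y hy)⟩
  · rw [hBR]
    have hH (x y : ℕ) : (∃ z, f (n, x, y, z)) ↔ ∃ s, haltsWithin c s (encode (n, x, y)) :=
      hc (n, x, y)
    simp only [hH]
    constructor
    · rintro ⟨x, hx⟩
      exact computablePred_of_initial_segments (p := fun e k => p n e k ∨ K e) (e₀ := x)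
        (fun e k k' hk => Or.imp_left (hp n e k k' hk))
        (fun e k he => .inl ⟨x, List.mem_range.2 (Nat.lt_succ_of_le he), fun y _ => hx y⟩)
    · intro hA
      by_contra hx
      push Not at hx
      choose y hy using hx
      have hgap (e : ℕ) : ∃ k, ¬ p n e k := by
        refine ⟨((List.range (e + 1)).map y).sum + 1, ?_⟩
        rintro ⟨x, hx, h⟩
        obtain ⟨s, hs⟩ := h (y x) (List.mem_range.2
          (Nat.lt_succ_of_le (List.le_sum_of_mem (List.mem_map_of_mem hx))))
        exact hy x s hs
      refine ComputablePred.halting_problem_not_re 0 ?_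
      obtain ⟨g, hg, hgA⟩ := ComputablePred.computable_iff.1 hA.not
      refine (REPred.of_exists (R := fun t : Code × ℕ => g (Nat.pair (encode t.1) t.2))
        (ComputablePred.computable_iff.2 ⟨_, hg.comp (Primrec₂.natPair.comp
          (Primrec.encode.comp Primrec.fst) Primrec.snd).to_comp, rfl⟩)).of_eq fun c => ?_
      simp only [← congrFun hgA, Set.mem_ofPred_eq, Nat.unpair_pair, K, ofNat_encode, not_or]
      exact ⟨fun ⟨_, _, h⟩ => h, fun h => (hgap (encode c)).imp fun _ h' => ⟨h', h⟩⟩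

/-! ### Ceers with classes of at most two elements -/

/-- The equivalence relation that identifies `2 * m` with `2 * m + 1` for `m ∈ A`. -/
def pairRel (A : Set ℕ) (x y : ℕ) : Prop := x = y ∨ (x / 2 = y / 2 ∧ x / 2 ∈ A)

theorem equivalence_pairRel (A : Set ℕ) : Equivalence (pairRel A) where
  refl x := .inl rfl
  symm := by
    rintro x y (rfl | ⟨h, hA⟩)
    · exact .inl rfl
    · exact .inr ⟨h.symm, h ▸ hA⟩
  trans := by
    rintro x y z (rfl | ⟨h, hA⟩) (rfl | ⟨h', hA'⟩)
    · exact .inl rfl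
    · exact .inr ⟨h', hA'⟩
    · exact .inr ⟨h, hA⟩
    · exact .inr ⟨h.trans h', hA⟩

theorem pairRel_two_mul {A : Set ℕ} {x y : ℕ} : pairRel A (2 * x) (2 * y) ↔ x = y := by
  unfold pairRel
  constructor
  · rintro (h | ⟨h, -⟩) <;> omega
  · rintro rfl
    exact .inl rfl

theorem pairRel_succ {A : Set ℕ} {m : ℕ} : pairRel A (2 * m) (2 * m + 1) ↔ m ∈ A := by
  have h₁ : 2 * m / 2 = m := by omega
  have h₂ : (2 * m + 1) / 2 = m := by omega
  simp [pairRel, h₁, h₂]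

theorem infinite_quotient_of_pairRel {i : ℕ} {A : Set ℕ} (h : (ceer i).r = pairRel A) :
    Infinite (Quotient (ceer i)) := by
  refine Infinite.of_injective (fun x : ℕ => (⟦2 * x⟧ : Quotient (ceer i))) fun x y hxy => ?_
  have : (ceer i).r (2 * x) (2 * y) := Quotient.exact hxy
  rwa [h, pairRel_two_mul] at this

/-- A uniformly c.e. family of sets has uniform ceer indices for the relations `pairRel`. -/
theorem exists_ceer_index_pairRel {A : ℕ → Set ℕ} (hA : REPred fun t : ℕ × ℕ => t.2 ∈ A t.1) :
    ∃ j : ℕ → ℕ, Computable j ∧ Function.Injective j ∧ ∀ n, (ceer (j n)).r = pairRel (A n) := by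
  refine exists_ceer_index ?_ fun n => equivalence_pairRel (A n)
  obtain ⟨c, hc⟩ := hA.exists_code
  have hx : Primrec fun t : (ℕ × ℕ × ℕ) × ℕ => t.1.2.1 :=
    Primrec.fst.comp (Primrec.snd.comp Primrec.fst)
  have hy : Primrec fun t : (ℕ × ℕ × ℕ) × ℕ => t.1.2.2 :=
    Primrec.snd.comp (Primrec.snd.comp Primrec.fst)
  have hd := Primrec.nat_div.comp hx (Primrec.const 2)
  refine (REPred.of_exists (R := fun t : (ℕ × ℕ × ℕ) × ℕ => t.1.2.1 = t.1.2.2 ∨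
    (t.1.2.1 / 2 = t.1.2.2 / 2 ∧ haltsWithin c t.2 (encode (t.1.1, t.1.2.1 / 2))))
    (PrimrecPred.computablePred ?_)).of_eq fun t => ?_
  · exact (Primrec.eq.comp hx hy).or <|
      (Primrec.eq.comp hd (Primrec.nat_div.comp hy (Primrec.const 2))).and <|
      Primrec.eq.comp (primrec_haltsWithin.comp ((Primrec.const c).pair (Primrec.snd.pair
        (Primrec.encode.comp ((Primrec.fst.comp Primrec.fst).pair hd))))) (Primrec.const true)
  · simp only [pairRel, hc (t.1, _), exists_or, exists_and_left, exists_const]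

/-! ### Words and their values -/

namespace GroupPresentation

variable {P : GroupPresentation}

theorem spell_injective : Function.Injective P.spell :=
  List.map_injective_iff.2 (Subtype.val_injective.prodMap Function.injective_id)

theorem spell_mem_words (u : List (P.gens × Bool)) : P.spell u ∈ P.words := ⟨u, rfl⟩

theorem wordProblem_spell {u v : List (P.gens × Bool)} :
    P.WordProblem (P.spell u) (P.spell v) ↔ P.value u = P.value v := by
  constructor
  · rintro ⟨u', v', hu, hv, h⟩
    rwa [spell_injective hu, spell_injective hv] at h
  · exact fun h => ⟨u, v, rfl, rfl, h⟩

theorem value_append (u v : List (P.gens × Bool)) : P.value (u ++ v) = P.value u * P.value v := by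
  rw [value, ← FreeGroup.mul_mk, map_mul]
  rfl

theorem value_invRev (u : List (P.gens × Bool)) : P.value (FreeGroup.invRev u) = (P.value u)⁻¹ := by
  rw [value, ← FreeGroup.inv_mk, map_inv]
  rfl

theorem spell_append (u v : List (P.gens × Bool)) : P.spell (u ++ v) = P.spell u ++ P.spell v :=
  List.map_append

theorem spell_invRev (u : List (P.gens × Bool)) :
    P.spell (FreeGroup.invRev u) = FreeGroup.invRev (P.spell u) := by
  simp [spell, FreeGroup.invRev, List.map_reverse, Function.comp_def]

end GroupPresentation

open GroupPresentation

theorem primrec_invRev : Primrec (FreeGroup.invRev : List (ℕ × Bool) → List (ℕ × Bool)) :=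
  Primrec.list_reverse.comp <| Primrec.list_map Primrec.id <|
    ((Primrec.fst.comp Primrec.snd).pair (Primrec.not.comp (Primrec.snd.comp Primrec.snd))).to₂

/-- A word problem is many-one reducible to any of its classes, because two words have the same
value if and only if the first followed by the formal inverse of the second has value `1`. The
classes of `pairRel A` are finite, hence only a computable `pairRel A` can be equivalent to a word
problem. -/
theorem computablePred_of_pairRel_equivalent_wordProblem {A : Set ℕ} {P : GroupPresentation}
    (h : ComputablyEquivalent Set.univ (pairRel A) P.words P.WordProblem) :
    ComputablePred fun m => m ∈ A := by
  classical
  obtain ⟨⟨f, hf, hfw, hfE⟩, g, hg, -, hgE⟩ := h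
  have key (m : ℕ) : m ∈ A ↔
      pairRel A (g (f (2 * m) ++ FreeGroup.invRev (f (2 * m + 1)))) (g []) := by
    rw [← pairRel_succ, hfE _ trivial _ trivial]
    obtain ⟨u, hu⟩ := hfw (2 * m) trivial
    obtain ⟨v, hv⟩ := hfw (2 * m + 1) trivial
    rw [← hu, ← hv, ← spell_invRev, ← spell_append]
    have hnil : ([] : List (ℕ × Bool)) = P.spell [] := rfl
    rw [hnil, ← hgE _ (spell_mem_words _) _ (spell_mem_words _), wordProblem_spell,
      wordProblem_spell, value_append, value_invRev]
    exact mul_inv_eq_one.symm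
  have hc : PrimrecPred fun z => pairRel A z (g []) := by
    have h' : PrimrecPred fun z : ℕ => z / 2 = g [] / 2 ∧ g [] / 2 ∈ A := by
      by_cases hA : g [] / 2 ∈ A
      · exact (Primrec.eq.comp (Primrec.nat_div.comp Primrec.id (Primrec.const 2))
          (Primrec.const (g [] / 2))).of_eq fun z => by simp [hA]
      · exact (Primrec.eq.comp (Primrec.const 0) (Primrec.const 1)).of_eq fun z => by simp [hA]
    refine ((Primrec.eq.comp Primrec.id (Primrec.const (g []))).or h').of_eq fun z => ?_
    refine or_congr_right ⟨fun ⟨h, hA⟩ => ⟨h, h ▸ hA⟩, fun ⟨h, hA⟩ => ⟨h, h ▸ hA⟩⟩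
  obtain ⟨d, hd, hdc⟩ := ComputablePred.computable_iff.1 hc.computablePred
  have h2 : Primrec fun m : ℕ => 2 * m := Primrec.nat_mul.comp (Primrec.const 2) Primrec.id
  refine ComputablePred.of_eq (ComputablePred.computable_iff.2 ⟨_, hd.comp (hg.comp
    (Computable.list_append.comp (hf.comp h2.to_comp) (primrec_invRev.to_comp.comp
      (hf.comp (Primrec.succ.comp h2).to_comp)))), rfl⟩) fun m => ?_
  rw [key, ← congrFun hdc]

/-! ### The infinite cyclic group -/

/-- The presentation of the infinite cyclic group with one generator and no relators. -/
def infiniteCyclic : GroupPresentation := ⟨{0}, ∅⟩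

/-- The number of letters of `w` that are generators, and not inverses if `b` is `true`; the number
of the others if `b` is `false`. -/
def signCount (b : Bool) (w : List (ℕ × Bool)) : ℕ := (w.filter fun l => l.2 = b).length

theorem primrec_signCount (b : Bool) : Primrec (signCount b) :=
  Primrec.list_length.comp <| Primrec.listFilter (p := fun l : ℕ × Bool => l.2 = b) <|
    Primrec.eq.comp Primrec.snd (Primrec.const b)

theorem value_infiniteCyclic_eq_iff {u v : List (infiniteCyclic.gens × Bool)} :
    infiniteCyclic.value u = infiniteCyclic.value v ↔
      (signCount true (infiniteCyclic.spell u) : ℤ) - signCount false (infiniteCyclic.spell u) =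
      signCount true (infiniteCyclic.spell v) - signCount false (infiniteCyclic.spell v) := by
  let a : infiniteCyclic.Carrier := PresentedGroup.of ⟨0, rfl⟩
  have hval (u : List (infiniteCyclic.gens × Bool)) : infiniteCyclic.value u =
      a ^ ((signCount true (infiniteCyclic.spell u) : ℤ) -
        signCount false (infiniteCyclic.spell u)) := by
    induction u with
    | nil => exact map_one _
    | cons l u ih =>
      obtain ⟨⟨x, rfl⟩, b⟩ := l
      rw [← List.singleton_append, value_append, ih, spell_append]
      have ha : infiniteCyclic.value [(⟨0, rfl⟩, true)] = a := rfl
      have ha' : infiniteCyclic.value [(⟨0, rfl⟩, false)] = a⁻¹ :=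
        value_invRev (P := infiniteCyclic) [(⟨0, rfl⟩, true)]
      cases b
      · rw [ha', ← zpow_neg_one, ← zpow_add]
        congr 1
        simp [signCount, spell]
        ring
      · rw [ha]
        nth_rw 1 [← zpow_one a]
        rw [← zpow_add]
        congr 1
        simp [signCount, spell]
        ring
  let φ : infiniteCyclic.Carrier →* Multiplicative ℤ :=
    PresentedGroup.toGroup (f := fun _ => Multiplicative.ofAdd 1) (by
      rintro _ ⟨r, hr, -⟩
      exact hr.elim)
  have hφ : φ a = Multiplicative.ofAdd 1 := PresentedGroup.toGroup.of _
  rw [hval, hval]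
  refine ⟨fun h => ?_, fun h => by rw [h]⟩
  have := congrArg φ h
  rw [map_zpow, map_zpow, hφ, ← ofAdd_zsmul, ← ofAdd_zsmul] at this
  simpa using! Multiplicative.ofAdd.injective this

theorem pairRel_equivalent_infiniteCyclic {A : Set ℕ} (hA : ComputablePred fun m => m ∈ A) :
    ComputablyEquivalent Set.univ (pairRel A) infiniteCyclic.words infiniteCyclic.WordProblem := by
  classical
  constructor
  · -- Every class has a canonical element, which serves as an exponent.
    let r (x : ℕ) : ℕ := if x / 2 ∈ A then 2 * (x / 2) else x
    have hd : Computable fun x : ℕ => x / 2 :=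
      (Primrec.nat_div.comp Primrec.id (Primrec.const 2)).to_comp
    have hr : Computable r := by
      obtain ⟨d, hdc, hdA⟩ := ComputablePred.computable_iff.1 hA
      refine ComputablePred.ite (Primrec.nat_mul.to_comp.comp (Computable.const 2) hd) Computable.id
        ((ComputablePred.computable_iff.2 ⟨_, hdc.comp hd, rfl⟩).of_eq fun x => ?_)
      rw [← congrFun hdA]
    have hrE (x y : ℕ) : pairRel A x y ↔ r x = r y := by
      simp only [pairRel, r]
      constructor
      · rintro (rfl | ⟨h, hA⟩)
        · rfl
        · rw [← h, if_pos hA, if_pos hA]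
      · split_ifs with h₁ h₂ h₂ <;> intro h
        · exact .inr ⟨by omega, h₁⟩
        · have : x / 2 = y / 2 := by omega
          exact .inr ⟨this, h₁⟩
        · have : x / 2 = y / 2 := by omega
          exact absurd (this ▸ h₂) h₁
        · exact .inl h
    have hspell (k : ℕ) : List.replicate k ((0 : ℕ), true) =
        infiniteCyclic.spell (List.replicate k (⟨0, rfl⟩, true)) := by
      simp [spell]
    have hrep : Primrec fun k : ℕ => List.replicate k ((0 : ℕ), true) :=
      (Primrec.list_map Primrec.list_range (Primrec.const ((0 : ℕ), true)).to₂).of_eq fun k => by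
        simp
    refine ⟨fun x => List.replicate (r x) (0, true), hrep.to_comp.comp hr, fun x _ => ?_,
      fun x _ y _ => ?_⟩
    · change List.replicate (r x) (0, true) ∈ _
      rw [hspell]
      exact spell_mem_words _
    · change _ ↔ infiniteCyclic.WordProblem (List.replicate (r x) (0, true))
        (List.replicate (r y) (0, true))
      rw [hrE, hspell, hspell, wordProblem_spell, value_infiniteCyclic_eq_iff, ← hspell, ← hspell]
      simp [signCount]
  · refine ⟨fun w => 2 * Nat.pair (signCount true w - signCount false w)
      (signCount false w - signCount true w), ?_, fun _ _ => trivial, ?_⟩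
    · have ht := primrec_signCount true
      have hf := primrec_signCount false
      exact (Primrec.nat_mul.comp (Primrec.const 2) (Primrec₂.natPair.comp
        (Primrec.nat_sub.comp ht hf) (Primrec.nat_sub.comp hf ht))).to_comp
    · rintro _ ⟨u, rfl⟩ _ ⟨v, rfl⟩
      rw [wordProblem_spell, value_infiniteCyclic_eq_iff, pairRel_two_mul, Nat.pair_eq_pair]
      omega

/-! ### Computable reducibility -/

theorem ComputablyReduces.trans {α β γ : Type} [Primcodable α] [Primcodable β] [Primcodable γ]
    {D : Set α} {E : α → α → Prop} {D' : Set β} {F : β → β → Prop} {D'' : Set γ}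
    {G : γ → γ → Prop} (h : ComputablyReduces D E D' F) (h' : ComputablyReduces D' F D'' G) :
    ComputablyReduces D E D'' G := by
  obtain ⟨f, hf, hfD, hE⟩ := h
  obtain ⟨g, hg, hgD, hF⟩ := h'
  exact ⟨fun x => g (f x), hg.comp hf, fun x hx => hgD _ (hfD x hx), fun x hx y hy =>
    (hE x hx y hy).trans (hF _ (hfD x hx) _ (hfD y hy))⟩

theorem ComputablyEquivalent.trans {α β γ : Type} [Primcodable α] [Primcodable β] [Primcodable γ]
    {D : Set α} {E : α → α → Prop} {D' : Set β} {F : β → β → Prop} {D'' : Set γ}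
    {G : γ → γ → Prop} (h : ComputablyEquivalent D E D' F) (h' : ComputablyEquivalent D' F D'' G) :
    ComputablyEquivalent D E D'' G :=
  ⟨h.1.trans h'.1, h'.2.trans h.2⟩

theorem ComputablyEquivalent.symm {α β : Type} [Primcodable α] [Primcodable β]
    {D : Set α} {E : α → α → Prop} {D' : Set β} {F : β → β → Prop}
    (h : ComputablyEquivalent D E D' F) : ComputablyEquivalent D' F D E :=
  ⟨h.2, h.1⟩

/-! ### Enumerating the word problem -/

theorem primrec_reduce :
    Primrec (FreeGroup.reduce : List (ℕ × Bool) → List (ℕ × Bool)) := by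
  have hx : Primrec fun t : (List (ℕ × Bool) × (ℕ × Bool) × List (ℕ × Bool)) ×
      (ℕ × Bool) × List (ℕ × Bool) => t.1.2.1 :=
    Primrec.fst.comp (Primrec.snd.comp Primrec.fst)
  have hy : Primrec fun t : (List (ℕ × Bool) × (ℕ × Bool) × List (ℕ × Bool)) ×
      (ℕ × Bool) × List (ℕ × Bool) => t.2.1 := Primrec.fst.comp Primrec.snd
  have hl : Primrec fun t : (List (ℕ × Bool) × (ℕ × Bool) × List (ℕ × Bool)) ×
      (ℕ × Bool) × List (ℕ × Bool) => t.2.2 := Primrec.snd.comp Primrec.snd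
  have hstep : Primrec₂ fun (_ : List (ℕ × Bool)) (t : (ℕ × Bool) × List (ℕ × Bool)) =>
      (List.casesOn t.2 [t.1] fun y l =>
        if t.1.1 = y.1 ∧ t.1.2 = !y.2 then l else t.1 :: y :: l : List (ℕ × Bool)) := by
    refine Primrec.list_casesOn (h := fun (t : List (ℕ × Bool) × (ℕ × Bool) × List (ℕ × Bool))
      (p : (ℕ × Bool) × List (ℕ × Bool)) =>
        if t.2.1.1 = p.1.1 ∧ t.2.1.2 = !p.1.2 then p.2 else t.2.1 :: p.1 :: p.2)
      (Primrec.snd.comp Primrec.snd)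
      (Primrec.list_cons.comp (Primrec.fst.comp Primrec.snd) (Primrec.const [])) ?_
    exact Primrec.ite ((Primrec.eq.comp (Primrec.fst.comp hx) (Primrec.fst.comp hy)).and
        (Primrec.eq.comp (Primrec.snd.comp hx) (Primrec.not.comp (Primrec.snd.comp hy)))) hl
      (Primrec.list_cons.comp hx (Primrec.list_cons.comp hy hl))
  refine (Primrec.list_foldr Primrec.id (Primrec.const []) hstep).of_eq fun w => ?_
  induction w with
  | nil => rfl
  | cons x w ih =>
    rw [FreeGroup.reduce.cons, ← ih]
    rfl

/-- The value of a word over `ℕ` in the group with generators `ℕ` and relators `R`. -/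
def ambientValue (R : Set (List (ℕ × Bool))) (w : List (ℕ × Bool)) :
    PresentedGroup (FreeGroup.mk '' R) :=
  PresentedGroup.mk (FreeGroup.mk '' R) (FreeGroup.mk w)

section ambientValue

variable {R : Set (List (ℕ × Bool))}

theorem ambientValue_append (u v : List (ℕ × Bool)) :
    ambientValue R (u ++ v) = ambientValue R u * ambientValue R v := by
  rw [ambientValue, ← FreeGroup.mul_mk, map_mul]
  rfl

theorem ambientValue_invRev (u : List (ℕ × Bool)) :
    ambientValue R (FreeGroup.invRev u) = (ambientValue R u)⁻¹ := by
  rw [ambientValue, ← FreeGroup.inv_mk, map_inv]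
  rfl

theorem ambientValue_eq_one_iff {w : List (ℕ × Bool)} :
    ambientValue R w = 1 ↔ FreeGroup.mk w ∈ Subgroup.normalClosure (FreeGroup.mk '' R) :=
  QuotientGroup.eq_one_iff _

theorem ambientValue_eq_one {w : List (ℕ × Bool)} (hw : w ∈ R) : ambientValue R w = 1 :=
  ambientValue_eq_one_iff.2 (Subgroup.subset_normalClosure ⟨w, hw, rfl⟩)

end ambientValue

/-- A single conjugate `g * r * g⁻¹` or `g * r⁻¹ * g⁻¹` of the relator `r` with number `p.2.2`. -/
def conjugate (ρ : ℕ → List (ℕ × Bool)) (p : List (ℕ × Bool) × Bool × ℕ) : List (ℕ × Bool) :=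
  p.1 ++ ((bif p.2.1 then ρ p.2.2 else FreeGroup.invRev (ρ p.2.2)) ++ FreeGroup.invRev p.1)

theorem ambientValue_range_eq_one_iff {ρ : ℕ → List (ℕ × Bool)} {w : List (ℕ × Bool)} :
    ambientValue (Set.range ρ) w = 1 ↔ ∃ L : List (List (ℕ × Bool) × Bool × ℕ),
      FreeGroup.reduce (L.flatMap (conjugate ρ)) = FreeGroup.reduce w := by
  constructor
  · rw [ambientValue_eq_one_iff]
    intro hw
    suffices h : ∃ L : List (List (ℕ × Bool) × Bool × ℕ),
        FreeGroup.mk (L.flatMap (conjugate ρ)) = FreeGroup.mk w from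
      h.imp fun _ => FreeGroup.reduce.sound
    refine Subgroup.closure_induction (p := fun g _ => ∃ L : List (List (ℕ × Bool) × Bool × ℕ),
      FreeGroup.mk (L.flatMap (conjugate ρ)) = g) ?_ ⟨[], rfl⟩ ?_ ?_ hw
    · intro x hx
      obtain ⟨_, ⟨_, ⟨t, rfl⟩, rfl⟩, hx⟩ := Group.mem_conjugatesOfSet_iff.1 hx
      obtain ⟨⟨g⟩, rfl⟩ := isConj_iff.1 hx
      exact ⟨[(g, true, t)], by simp [conjugate, FreeGroup.quot_mk_eq_mk]⟩
    · rintro _ _ _ _ ⟨L, rfl⟩ ⟨L', rfl⟩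
      exact ⟨L ++ L', by simp⟩
    · rintro _ - ⟨L, rfl⟩
      induction L with
      | nil => exact ⟨[], rfl⟩
      | cons p L ih =>
        obtain ⟨L', h'⟩ := ih
        obtain ⟨g, b, t⟩ := p
        have hp : FreeGroup.mk (conjugate ρ (g, !b, t)) =
            (FreeGroup.mk (conjugate ρ (g, b, t)))⁻¹ := by
          cases b <;> simp [conjugate, FreeGroup.invRev_append, FreeGroup.invRev_invRev]
        refine ⟨L' ++ [(g, !b, t)], ?_⟩
        rw [List.flatMap_append, List.flatMap_singleton, ← FreeGroup.mul_mk, h', hp,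
          List.flatMap_cons, ← FreeGroup.mul_mk, mul_inv_rev]
  · rintro ⟨L, hL⟩
    rw [ambientValue, ← FreeGroup.reduce.exact hL]
    change ambientValue _ _ = 1
    clear hL
    induction L with
    | nil => exact map_one _
    | cons p L ih =>
      have hp : ambientValue (Set.range ρ) (ρ p.2.2) = 1 := ambientValue_eq_one ⟨_, rfl⟩
      rw [List.flatMap_cons, ambientValue_append, ih, conjugate, ambientValue_append,
        ambientValue_append]
      cases p.2.1 <;> simp [hp, ambientValue_invRev]

theorem rePred_ambientValue_eq {α : Type} [Primcodable α] {ρ : α → ℕ → List (ℕ × Bool)}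
    {w : α → ℕ → List (ℕ × Bool)} (hρ : Primrec₂ ρ) (hw : Primrec₂ w) :
    REPred fun t : α × ℕ × ℕ => ambientValue (Set.range (ρ t.1)) (w t.1 t.2.1) =
      ambientValue (Set.range (ρ t.1)) (w t.1 t.2.2) := by
  have hconj : Primrec₂ fun (t : (α × ℕ × ℕ) × List (List (ℕ × Bool) × Bool × ℕ))
      (p : List (ℕ × Bool) × Bool × ℕ) => conjugate (ρ t.1.1) p := by
    have hg : Primrec fun t : ((α × ℕ × ℕ) × List (List (ℕ × Bool) × Bool × ℕ)) ×
        List (ℕ × Bool) × Bool × ℕ => t.2.1 := Primrec.fst.comp Primrec.snd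
    have hr : Primrec fun t : ((α × ℕ × ℕ) × List (List (ℕ × Bool) × Bool × ℕ)) ×
        List (ℕ × Bool) × Bool × ℕ => ρ t.1.1.1 t.2.2.2 :=
      hρ.comp (Primrec.fst.comp (Primrec.fst.comp Primrec.fst))
        (Primrec.snd.comp (Primrec.snd.comp Primrec.snd))
    exact Primrec.list_append.comp hg <| Primrec.list_append.comp
      (Primrec.cond (Primrec.fst.comp (Primrec.snd.comp Primrec.snd)) hr (primrec_invRev.comp hr))
      (primrec_invRev.comp hg)
  refine (REPred.of_exists
    (R := fun t : (α × ℕ × ℕ) × List (List (ℕ × Bool) × Bool × ℕ) =>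
      FreeGroup.reduce (t.2.flatMap (conjugate (ρ t.1.1))) =
      FreeGroup.reduce (w t.1.1 t.1.2.1 ++ FreeGroup.invRev (w t.1.1 t.1.2.2)))
    (PrimrecPred.computablePred ?_)).of_eq fun t => ?_
  · have ha := Primrec.fst.comp (Primrec.fst (α := α × ℕ × ℕ)
      (β := List (List (ℕ × Bool) × Bool × ℕ)))
    have hxy := Primrec.snd.comp (Primrec.fst (α := α × ℕ × ℕ)
      (β := List (List (ℕ × Bool) × Bool × ℕ)))
    exact Primrec.eq.comp (primrec_reduce.comp (Primrec.list_flatMap Primrec.snd hconj))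
      (primrec_reduce.comp (Primrec.list_append.comp
        (hw.comp ha (Primrec.fst.comp hxy))
        (primrec_invRev.comp (hw.comp ha (Primrec.snd.comp hxy)))))
  · dsimp only
    rw [← ambientValue_range_eq_one_iff, ambientValue_append, ambientValue_invRev, mul_inv_eq_one]

/-! ### Enlarging the set of generators -/

namespace GroupPresentation

variable {P : GroupPresentation}

theorem mem_words_iff {w : List (ℕ × Bool)} : w ∈ P.words ↔ ∀ l ∈ w, l.1 ∈ P.gens := by
  constructor
  · rintro ⟨u, rfl⟩ l hl
    obtain ⟨l', -, rfl⟩ := List.mem_map.1 hl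
    exact l'.1.2
  · intro h
    induction w with
    | nil => exact ⟨[], rfl⟩
    | cons l w ih =>
      obtain ⟨u, hu⟩ := ih fun l' hl' => h l' (List.mem_cons_of_mem _ hl')
      exact ⟨(⟨l.1, h l List.mem_cons_self⟩, l.2) :: u, congrArg (List.cons l) hu⟩

open Classical in
/-- The homomorphism to the presented group that kills the numbers outside the set of generators. -/
noncomputable def kill (P : GroupPresentation) : FreeGroup ℕ →* P.Carrier :=
  FreeGroup.lift fun n => if h : n ∈ P.gens then PresentedGroup.of ⟨n, h⟩ else 1

theorem kill_spell (u : List (P.gens × Bool)) : P.kill (FreeGroup.mk (P.spell u)) = P.value u := by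
  have h : P.kill.comp (FreeGroup.map Subtype.val) =
      PresentedGroup.mk (FreeGroup.mk '' P.rels) := by
    ext x
    simp [kill, PresentedGroup.of]
  exact DFunLike.congr_fun h (FreeGroup.mk u)

theorem kill_cons (l : ℕ × Bool) (w : List (ℕ × Bool)) :
    P.kill (FreeGroup.mk (l :: w)) = P.kill (FreeGroup.mk [l]) * P.kill (FreeGroup.mk w) := by
  rw [← map_mul, FreeGroup.mul_mk, List.singleton_append]

theorem kill_letter {n : ℕ} (h : n ∉ P.gens) (b : Bool) : P.kill (FreeGroup.mk [(n, b)]) = 1 := by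
  cases b <;> simp [kill, h]

theorem kill_filter {g : ℕ → Bool} (h : ∀ n ∈ P.gens, g n) (w : List (ℕ × Bool)) :
    P.kill (FreeGroup.mk (w.filter fun l => g l.1)) = P.kill (FreeGroup.mk w) := by
  induction w with
  | nil => rfl
  | cons l w ih =>
    rw [kill_cons, List.filter_cons]
    split_ifs with hl
    · rw [kill_cons, ih]
    · rw [ih, kill_letter fun hn => hl (h _ hn), one_mul]

/-- The presented group embeds in the group with generators `ℕ` and relators `R`, of which it is a
retract by `kill`. -/
theorem value_eq_iff_ambientValue_eq {R : Set (List (ℕ × Bool))}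
    (h₁ : ∀ r ∈ P.rels, ambientValue R (P.spell r) = 1)
    (h₂ : ∀ r ∈ R, P.kill (FreeGroup.mk r) = 1) {u v : List (P.gens × Bool)} :
    P.value u = P.value v ↔ ambientValue R (P.spell u) = ambientValue R (P.spell v) := by
  have hmap (u : List (P.gens × Bool)) :
      FreeGroup.lift (fun x : P.gens => PresentedGroup.of (rels := FreeGroup.mk '' R) x.1)
        (FreeGroup.mk u) = ambientValue R (P.spell u) := by
    have h : FreeGroup.lift (fun x : P.gens => PresentedGroup.of (rels := FreeGroup.mk '' R) x.1) =
        (PresentedGroup.mk (FreeGroup.mk '' R)).comp (FreeGroup.map Subtype.val) := by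
      ext x
      simp [PresentedGroup.of]
    rw [h]
    rfl
  constructor
  · intro h
    have := congrArg (PresentedGroup.toGroup (f := fun x : P.gens =>
      PresentedGroup.of (rels := FreeGroup.mk '' R) x.1) (by
        rintro _ ⟨r, hr, rfl⟩
        rw [hmap, h₁ r hr])) h
    exact (hmap u).symm.trans (this.trans (hmap v))
  · intro h
    have hR : ∀ r ∈ FreeGroup.mk '' R, P.kill r = 1 := by
      rintro _ ⟨r, hr, rfl⟩
      exact h₂ r hr
    have := congrArg (PresentedGroup.toGroup hR) h
    exact (kill_spell u).symm.trans (Eq.trans this (kill_spell v))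

/-- The presentation with the set of generators `G` and the enumerated relators `ρ t`. -/
def ofEnum (G : Set ℕ) (ρ : ℕ → List (ℕ × Bool)) : GroupPresentation :=
  ⟨G, {u | ∃ t, u.map (Prod.map Subtype.val id) = ρ t}⟩

theorem spell_image_ofEnum {G : Set ℕ} {ρ : ℕ → List (ℕ × Bool)} (h : ∀ t, ∀ l ∈ ρ t, l.1 ∈ G) :
    (ofEnum G ρ).spell '' (ofEnum G ρ).rels = Set.range ρ := by
  ext w
  constructor
  · rintro ⟨u, ⟨t, ht⟩, rfl⟩
    exact ⟨t, ht.symm⟩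
  · rintro ⟨t, rfl⟩
    obtain ⟨u, hu⟩ := mem_words_iff (P := ofEnum G ρ).2 (h t)
    exact ⟨u, ⟨t, hu⟩, hu⟩

theorem wordProblem_ofEnum_iff {G : Set ℕ} {ρ : ℕ → List (ℕ × Bool)}
    (h : ∀ t, ∀ l ∈ ρ t, l.1 ∈ G) {w w' : List (ℕ × Bool)} (hw : w ∈ (ofEnum G ρ).words)
    (hw' : w' ∈ (ofEnum G ρ).words) : (ofEnum G ρ).WordProblem w w' ↔
      ambientValue (Set.range ρ) w = ambientValue (Set.range ρ) w' := by
  obtain ⟨u, rfl⟩ := hw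
  obtain ⟨v, rfl⟩ := hw'
  rw [wordProblem_spell]
  apply value_eq_iff_ambientValue_eq
  · rintro r ⟨t, ht⟩
    exact ambientValue_eq_one ⟨t, ht.symm⟩
  · rw [← spell_image_ofEnum h]
    rintro _ ⟨r, hr, rfl⟩
    rw [kill_spell]
    exact (PresentedGroup.one_of_mem ⟨r, hr, rfl⟩)

end GroupPresentation

theorem ambientValue_filter {R : Set (List (ℕ × Bool))} {g : ℕ → Bool} {w : List (ℕ × Bool)}
    (h : ∀ l ∈ w, g l.1 = false → ambientValue R [(l.1, true)] = 1) :
    ambientValue R (w.filter fun l => g l.1) = ambientValue R w := by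
  induction w with
  | nil => rfl
  | cons l w ih =>
    have ih := ih fun l' hl' => h l' (List.mem_cons_of_mem _ hl')
    rw [← List.singleton_append, ambientValue_append, List.filter_append, ambientValue_append, ih]
    congr 1
    cases hl : g l.1
    · have h₁ := h l List.mem_cons_self hl
      have h₂ : ambientValue R [l] = 1 := by
        obtain ⟨n, b⟩ := l
        cases b
        · have := ambientValue_invRev (R := R) [(n, true)]
          rw [h₁, inv_one] at this
          exact this
        · exact h₁
      rw [h₂, List.filter_singleton, hl]
      exact map_one _
    · rw [List.filter_singleton, hl]
      rfl

theorem Computable.list_filter {β : Type*} [Primcodable β] {g : β → Bool} (hg : Computable g) :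
    Computable fun w : List β => w.filter g := by
  have h : Computable₂ fun (w : List β) (t : ℕ × List β) =>
      t.2 ++ (Option.casesOn w[t.1]? [] fun l => bif g l then [l] else [] : List β) := by
    refine Computable.list_append.comp (Computable.snd.comp Computable.snd)
      (Computable.option_casesOn (Computable.list_getElem?.comp Computable.fst
        (Computable.fst.comp Computable.snd)) (Computable.const []) ?_)
    exact Computable.cond (hg.comp Computable.snd)
      (Computable.list_cons.comp Computable.snd (Computable.const [])) (Computable.const [])
  refine (Computable.nat_rec Computable.list_length (Computable.const []) h).of_eq fun w => ?_
  have key (k : ℕ) : (Nat.rec [] (fun n acc =>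
      acc ++ (Option.casesOn w[n]? [] fun l => bif g l then [l] else [] : List β)) k : List β) =
        (w.take k).filter g := by
    induction k with
    | zero => simp
    | succ k ih =>
      simp only [ih, List.take_add_one, List.filter_append]
      congr 1
      cases w[k]? with
      | none => rfl
      | some l => cases hl : g l <;> simp [hl]
  simpa using! key w.length

/-- Tietze's move: adding generators that become trivial does not change the group. -/
theorem computablyEquivalent_ofEnum {P : GroupPresentation}
    (hP : ComputablePred fun n => n ∈ P.gens) {G : Set ℕ} {ρ : ℕ → List (ℕ × Bool)}
    (hG : P.gens ⊆ G) (hρ : ∀ t, ∀ l ∈ ρ t, l.1 ∈ G)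
    (h₁ : ∀ r ∈ P.rels, ambientValue (Set.range ρ) (P.spell r) = 1)
    (h₂ : ∀ n ∈ G, n ∉ P.gens → ambientValue (Set.range ρ) [(n, true)] = 1)
    (h₃ : ∀ t, P.kill (FreeGroup.mk (ρ t)) = 1) :
    ComputablyEquivalent P.words P.WordProblem (ofEnum G ρ).words (ofEnum G ρ).WordProblem := by
  have hPW {w w' : List (ℕ × Bool)} (hw : w ∈ P.words) (hw' : w' ∈ P.words) :
      P.WordProblem w w' ↔
        ambientValue (Set.range ρ) w = ambientValue (Set.range ρ) w' := by
    obtain ⟨u, rfl⟩ := hw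
    obtain ⟨v, rfl⟩ := hw'
    rw [wordProblem_spell]
    exact value_eq_iff_ambientValue_eq h₁ (by rintro _ ⟨t, rfl⟩; exact h₃ t)
  obtain ⟨g, hg, hgP⟩ := ComputablePred.computable_iff.1 hP
  have hgP (n : ℕ) : n ∈ P.gens ↔ g n = true := iff_of_eq (congrFun hgP n)
  constructor
  · have hid {w : List (ℕ × Bool)} (hw : w ∈ P.words) : w ∈ (ofEnum G ρ).words :=
      mem_words_iff.2 fun l hl => hG (mem_words_iff.1 hw l hl)
    refine ⟨id, Computable.id, fun w hw => hid hw, fun w hw w' hw' => ?_⟩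
    rw [hPW hw hw']
    exact (wordProblem_ofEnum_iff hρ (hid hw) (hid hw')).symm
  · have hf (w : List (ℕ × Bool)) : (w.filter fun l => g l.1) ∈ P.words :=
      mem_words_iff.2 fun l hl => (hgP _).2 (List.mem_filter.1 hl).2
    have hv {w : List (ℕ × Bool)} (hw : w ∈ (ofEnum G ρ).words) :
        ambientValue (Set.range ρ) (w.filter fun l => g l.1) = ambientValue (Set.range ρ) w :=
      ambientValue_filter fun l hl hgl => h₂ _ (mem_words_iff.1 hw l hl) (by simp [hgP, hgl])
    refine ⟨_, Computable.list_filter (hg.comp Computable.fst), fun w _ => hf w,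
      fun w hw w' hw' => ?_⟩
    rw [hPW (hf w) (hf w'), hv hw, hv hw', wordProblem_ofEnum_iff hρ hw hw']

/-! ### Index sets of word problems -/

/-- The word with code `n`, and the empty word if there is none. -/
def wordOfCode (n : ℕ) : List (ℕ × Bool) := (decode n).getD []

theorem wordOfCode_encode (w : List (ℕ × Bool)) : wordOfCode (encode w) = w := by
  rw [wordOfCode, encodek, Option.getD_some]

theorem primrec_wordOfCode : Primrec wordOfCode :=
  Primrec.option_getD.comp Primrec.decode (Primrec.const [])

/-- A uniformly enumerated family of presentations: `gen a` is the set of generators and `ρ a` the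
enumeration of the relators of the presentation with parameter `a`. Its word problems have uniform
ceer indices. -/
theorem exists_ceer_index_wordProblem {α : Type} [Primcodable α] {gen : α → ℕ → Bool}
    {ρ : α → ℕ → List (ℕ × Bool)} (hgen : Primrec₂ gen) (hρ : Primrec₂ ρ)
    (hρgen : ∀ a t, ∀ l ∈ ρ a t, gen a l.1) :
    ∃ j : α → ℕ, Computable j ∧ ∀ a, ComputablyEquivalent Set.univ (ceer (j a)).r
      (ofEnum {n | gen a n} (ρ a)).words (ofEnum {n | gen a n} (ρ a)).WordProblem := by
  -- Every number codes a word over the generators, once foreign letters are left out.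
  let w (a : α) (x : ℕ) : List (ℕ × Bool) := (wordOfCode x).filter fun l => gen a l.1
  have hw : Primrec₂ w := by
    have hR : PrimrecRel fun (l : ℕ × Bool) (a : α) => gen a l.1 = true :=
      Primrec.eq.comp (hgen.comp Primrec.snd (Primrec.fst.comp Primrec.fst)) (Primrec.const true)
    refine (hR.listFilter.comp (primrec_wordOfCode.comp Primrec.snd) Primrec.fst).of_eq fun t => ?_
    simp [w]
  have hwP (a : α) (x : ℕ) : w a x ∈ (ofEnum {n | gen a n} (ρ a)).words :=
    mem_words_iff.2 fun l hl => by simpa using! (List.mem_filter.1 hl).2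
  have hwe {a : α} {u : List (ℕ × Bool)} (hu : u ∈ (ofEnum {n | gen a n} (ρ a)).words) :
      w a (encode u) = u := by
    simp only [w, wordOfCode_encode]
    exact List.filter_eq_self.2 fun l hl => mem_words_iff.1 hu l hl
  obtain ⟨j, hj, -, hjE⟩ := exists_ceer_index
    (Q := fun a x y =>
      ambientValue (Set.range (ρ a)) (w a x) = ambientValue (Set.range (ρ a)) (w a y))
    (rePred_ambientValue_eq hρ hw) fun a => ⟨fun _ => rfl, Eq.symm, Eq.trans⟩
  have hWP (a : α) {u v : List (ℕ × Bool)} (hu : u ∈ (ofEnum {n | gen a n} (ρ a)).words)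
      (hv : v ∈ (ofEnum {n | gen a n} (ρ a)).words) :=
    wordProblem_ofEnum_iff (hρgen a) hu hv
  refine ⟨j, hj, fun a => ⟨⟨w a, (hw.comp (Primrec.const a) Primrec.id).to_comp,
    fun x _ => hwP a x, fun x _ y _ => ?_⟩, encode, Computable.encode, fun _ _ => trivial,
    fun u hu v hv => ?_⟩⟩
  · rw [hjE, hWP a (hwP a x) (hwP a y)]
  · rw [hjE, hWP a hu hv]
    simp only [hwe hu, hwe hv]

/-- The `Σ⁰₃`-hardness of the index set. A single reduction serves all classes of presentations: its
positive values are equivalent to the word problem of the infinite cyclic group, its negative values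
to that of no presentation at all. -/
theorem infinite_ceers_reduction {C : GroupPresentation → Prop} (hC : C infiniteCyclic) {B : Set ℕ}
    (hB : IsSigmaThree B) : ∃ f : ℕ → ℕ, Computable f ∧ Function.Injective f ∧
      (∀ n, Infinite (Quotient (ceer (f n)))) ∧ ∀ n, n ∈ B ↔ f n ∈ wordProblemIndices C := by
  obtain ⟨A, hA, hBA⟩ := exists_computable_iff_mem_of_isSigmaThree hB
  obtain ⟨f, hf, hfi, hfE⟩ := exists_ceer_index_pairRel hA
  refine ⟨f, hf, hfi, fun n => infinite_quotient_of_pairRel (hfE n), fun n => ?_⟩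
  rw [hBA, wordProblemIndices, Set.mem_ofPred_eq, hfE]
  exact ⟨fun h => ⟨_, hC, pairRel_equivalent_infiniteCyclic h⟩,
    fun ⟨_, _, h⟩ => computablePred_of_pairRel_equivalent_wordProblem h⟩

/-- The index set of the word problems of a class of presentations is `Σ⁰₃`-complete and the closure
of a c.e. set, if up to equivalence of word problems the class is uniformly enumerated, and if it
contains the infinite cyclic group. -/
theorem isSigmaThreeComplete_and_isCEProper {C : GroupPresentation → Prop} {α : Type}
    [Primcodable α] {gen : α → ℕ → Bool} {ρ : α → ℕ → List (ℕ × Bool)} (hgen : Primrec₂ gen)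
    (hρ : Primrec₂ ρ) (hρgen : ∀ a t, ∀ l ∈ ρ a t, gen a l.1) (hC : C infiniteCyclic)
    (hCρ : ∀ a, C (ofEnum {n | gen a n} (ρ a)))
    (hρC : ∀ P, C P → ∃ a, ComputablyEquivalent P.words P.WordProblem
      (ofEnum {n | gen a n} (ρ a)).words (ofEnum {n | gen a n} (ρ a)).WordProblem) :
    IsSigmaThreeComplete (wordProblemIndices C) ∧ IsCEProper (wordProblemIndices C) := by
  obtain ⟨j, hj, hjE⟩ := exists_ceer_index_wordProblem hgen hρ hρgen
  have hS : REPred fun n => n ∈ Set.range j :=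
    REPred.of_exists (R := fun t : ℕ × α => j t.2 = t.1) <| Computable.computablePred <|
      Primrec.eq.decide.to_comp.comp (hj.comp Computable.snd) Computable.fst
  have hSC : ceerClosure (Set.range j) = wordProblemIndices C := by
    ext i
    constructor
    · rintro ⟨_, ⟨a, rfl⟩, h⟩
      exact ⟨_, hCρ a, h.trans (hjE a)⟩
    · rintro ⟨P, hP, h⟩
      obtain ⟨a, ha⟩ := hρC P hP
      exact ⟨_, ⟨a, rfl⟩, (h.trans ha).trans (hjE a).symm⟩
  refine ⟨⟨hSC ▸ isSigmaThree_ceerClosure hS, fun B hB => ?_⟩, Set.range j, hS, ?_, hSC⟩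
  · obtain ⟨f, hf, hfi, -, hfB⟩ := infinite_ceers_reduction hC hB
    exact ⟨f, hf, hfi, hfB⟩
  · have hB : IsSigmaThree {0} := ⟨fun t => t.1 = 0, (Primrec.eq.comp Primrec.fst
      (Primrec.const 0)).computablePred, fun n => by simp⟩
    obtain ⟨f, -, -, hfinf, hfB⟩ := infinite_ceers_reduction hC hB
    rw [ProperOnInfiniteCeers, hSC]
    exact ⟨⟨f 0, hfinf 0, (hfB 0).1 rfl⟩, f 1, hfinf 1, fun h => one_ne_zero ((hfB 1).2 h)⟩

theorem isRecursive_infiniteCyclic : infiniteCyclic.IsRecursive := by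
  refine ⟨(Primrec.eq.comp Primrec.id (Primrec.const 0)).computablePred, ?_⟩
  refine (Primrec.eq.comp (Primrec.const 0) (Primrec.const 1)).computablePred.of_eq fun w => ?_
  simp [infiniteCyclic]

theorem primrec_filter_le :
    Primrec₂ fun (w : List (ℕ × Bool)) (k : ℕ) => w.filter fun l => decide (l.1 ≤ k) :=
  PrimrecRel.listFilter (R := fun (l : ℕ × Bool) (k : ℕ) => l.1 ≤ k)
    (Primrec.nat_le.comp (Primrec.fst.comp Primrec.fst) Primrec.snd)

/-! ### Finite presentations -/

theorem wordProblemIndices_isFinite :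
    IsSigmaThreeComplete (wordProblemIndices IsFinite) ∧
      IsCEProper (wordProblemIndices IsFinite) := by
  -- The parameter is a bound on the generators together with a list of relators.
  refine isSigmaThreeComplete_and_isCEProper (α := ℕ × List (List (ℕ × Bool)))
    (gen := fun a n => decide (n ≤ a.1))
    (ρ := fun a t => (a.2.getD t []).filter fun l => decide (l.1 ≤ a.1)) ?_ ?_ ?_ ?_ ?_ ?_
  · exact Primrec.nat_le.decide.comp Primrec.snd (Primrec.fst.comp Primrec.fst)
  · exact primrec_filter_le.comp ((Primrec.list_getD []).comp (Primrec.snd.comp Primrec.fst)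
      Primrec.snd) (Primrec.fst.comp Primrec.fst)
  · exact fun a t l hl => (List.mem_filter.1 hl).2
  · exact ⟨Set.finite_singleton 0, Set.finite_empty⟩
  · rintro ⟨k, R⟩
    refine ⟨?_, ?_⟩
    · exact (Set.finite_Iic k).subset fun n hn => of_decide_eq_true hn
    · refine Set.Finite.of_finite_image (f := (ofEnum {n | decide (n ≤ k)} _).spell) ?_
        spell_injective.injOn
      refine (List.finite_toSet (([] :: R).map
        fun w => w.filter fun l => decide (l.1 ≤ k))).subset ?_
      rintro _ ⟨u, ⟨t, ht⟩, rfl⟩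
      refine List.mem_map.2 ⟨R.getD t [], ?_, ht.symm⟩
      rw [List.getD_eq_getElem?_getD]
      cases h : R[t]? with
      | none => exact List.mem_cons_self
      | some w => exact List.mem_cons_of_mem _ (List.mem_of_getElem? h)
  · rintro P ⟨hX, hR⟩
    obtain ⟨k, hk⟩ := hX.bddAbove
    have hfin : (P.spell '' P.rels ∪ (fun n => [(n, true)]) '' (Set.Iic k \ P.gens)).Finite :=
      (hR.image _).union (((Set.finite_Iic k).subset Set.sdiff_subset).image _)
    let R := hfin.toFinset.toList
    have hmem {w : List (ℕ × Bool)} : w ∈ R ↔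
        w ∈ P.spell '' P.rels ∪ (fun n => [(n, true)]) '' (Set.Iic k \ P.gens) := by
      simp [R]
    have hone {w : List (ℕ × Bool)} (hw : w ∈ R) (hk : ∀ l ∈ w, l.1 ≤ k) :
        ambientValue (Set.range fun t => (R.getD t []).filter fun l => decide (l.1 ≤ k)) w = 1 := by
      obtain ⟨t, ht⟩ := List.mem_iff_getElem?.1 hw
      refine ambientValue_eq_one ⟨t, ?_⟩
      simp only [List.getD_eq_getElem?_getD, ht, Option.getD_some]
      exact List.filter_eq_self.2 fun l hl => decide_eq_true (hk l hl)
    have hdec : ComputablePred fun n => n ∈ P.gens := by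
      refine PrimrecPred.computablePred ((PrimrecPred.comp (PrimrecRel.exists_mem_list
        Primrec.eq) (Primrec.pair (Primrec.const hX.toFinset.toList) Primrec.id)).of_eq fun n => ?_)
      simp
    refine ⟨(k, R), computablyEquivalent_ofEnum hdec (fun n hn => decide_eq_true (hk hn))
      (fun t l hl => (List.mem_filter.1 hl).2) (fun r hr => ?_) (fun n hn hnP => ?_) fun t => ?_⟩
    · exact hone (hmem.2 (.inl ⟨r, hr, rfl⟩)) fun l hl =>
        hk (mem_words_iff.1 (spell_mem_words r) l hl)
    · have hn : n ≤ k := of_decide_eq_true hn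
      exact hone (hmem.2 (.inr ⟨n, ⟨hn, hnP⟩, rfl⟩)) fun l hl => by
        rw [List.mem_singleton.1 hl]
        exact hn
    · rw [kill_filter (g := fun n => decide (n ≤ k)) fun n hn => decide_eq_true (hk hn),
        List.getD_eq_getElem?_getD]
      cases h : R[t]? with
      | none => exact map_one _
      | some w =>
        rcases hmem.1 (List.mem_of_getElem? h) with ⟨r, hr, rfl⟩ | ⟨n, ⟨-, hn⟩, rfl⟩
        · exact (kill_spell r).trans (PresentedGroup.one_of_mem ⟨r, hr, rfl⟩)
        · exact kill_letter hn true

/-! ### Recursive presentations -/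

/-- The word `(x x⁻¹) ^ t` for the generator `x = 0`. -/
def padding (t : ℕ) : List (ℕ × Bool) :=
  (List.range t).flatMap fun _ => [(0, true), (0, false)]

theorem length_padding (t : ℕ) : (padding t).length = 2 * t := by
  simp [padding, mul_comm]

theorem mk_padding (t : ℕ) : FreeGroup.mk (padding t) = 1 := by
  have h : FreeGroup.mk [((0 : ℕ), true), (0, false)] = 1 :=
    Quot.sound (FreeGroup.Red.Step.not (L₁ := []) (L₂ := []))
  unfold padding
  induction List.range t with
  | nil => rfl
  | cons _ L ih => rw [List.flatMap_cons, ← FreeGroup.mul_mk, ih, h, one_mul]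

/-- The `t`-th relator enumerated by the program `c`, with letters outside `g` left out. It is the
word that is coded by the second component of `t`, if `c` halts on it within a number of steps given
by the first component, and otherwise the empty word, followed by a padding. The padding bounds `t`
by the length of the relator, so that the set of relators is computable. -/
def enumRelator (g : ℕ → Bool) (c : Code) (t : ℕ) : List (ℕ × Bool) :=
  (bif haltsWithin c t.unpair.1 (encode (wordOfCode t.unpair.2)) then
    (wordOfCode t.unpair.2).filter fun l => g l.1 else []) ++ padding t

theorem mem_of_mem_enumRelator {g : ℕ → Bool} (hg : g 0) {c : Code} {t : ℕ} {l : ℕ × Bool}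
    (hl : l ∈ enumRelator g c t) : g l.1 := by
  rcases List.mem_append.1 hl with hl | hl
  · cases h : haltsWithin c t.unpair.1 (encode (wordOfCode t.unpair.2)) <;> simp [h] at hl
    exact hl.2
  · obtain ⟨-, -, hl⟩ := List.mem_flatMap.1 hl
    rcases List.mem_pair.1 hl with rfl | rfl <;> exact hg

theorem primrec_enumRelator {α : Type} [Primcodable α] {g : α → ℕ → Bool} {c : α → Code}
    (hg : Primrec₂ g) (hc : Primrec c) : Primrec₂ fun a t => enumRelator (g a) (c a) t := by
  have ht : Primrec fun p : α × ℕ => p.2.unpair := Primrec.unpair.comp Primrec.snd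
  have hR : PrimrecRel fun (l : ℕ × Bool) (a : α) => g a l.1 = true :=
    Primrec.eq.comp (hg.comp Primrec.snd (Primrec.fst.comp Primrec.fst)) (Primrec.const true)
  have hw := primrec_wordOfCode.comp (Primrec.snd.comp ht)
  have hf : Primrec fun p : α × ℕ => (wordOfCode p.2.unpair.2).filter fun l => g p.1 l.1 := by
    refine (hR.listFilter.comp hw Primrec.fst).of_eq fun p => ?_
    simp
  exact Primrec.list_append.comp
    (Primrec.cond (primrec_haltsWithin.comp ((hc.comp Primrec.fst).pair
      ((Primrec.fst.comp ht).pair (Primrec.encode.comp hw)))) hf (Primrec.const []))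
    (Primrec.list_flatMap (Primrec.list_range.comp Primrec.snd)
      (Primrec.const [((0 : ℕ), true), (0, false)]).to₂)

theorem isRecursive_ofEnum_enumRelator {g : ℕ → Bool} (hg : Primrec g) (hg₀ : g 0) (c : Code) :
    (ofEnum {n | g n} (enumRelator g c)).IsRecursive := by
  refine ⟨(Primrec.eq.comp hg (Primrec.const true)).computablePred, ?_⟩
  rw [spell_image_ofEnum fun t l hl => mem_of_mem_enumRelator hg₀ hl]
  have hρ : Primrec (enumRelator g c) :=
    (primrec_enumRelator (α := Unit) (g := fun _ => g) (c := fun _ => c) (hg.comp Primrec.snd)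
      (Primrec.const c)).comp (Primrec.const ()) Primrec.id
  have hR : PrimrecRel fun (t : ℕ) (w : List (ℕ × Bool)) => enumRelator g c t = w :=
    Primrec.eq.comp (hρ.comp Primrec.fst) Primrec.snd
  refine (hR.exists_mem_list.comp (Primrec.list_range.comp (Primrec.succ.comp Primrec.list_length))
    Primrec.id).computablePred.of_eq fun w => ?_
  constructor
  · rintro ⟨t, -, h⟩
    exact ⟨t, h⟩
  · rintro ⟨t, rfl⟩
    have := length_padding t
    refine ⟨t, List.mem_range.2 ?_, rfl⟩
    simp only [enumRelator, List.length_append]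
    omega

/-- The relators of a recursive presentation, and its superfluous generators, are enumerated by some
program. -/
theorem exists_computablyEquivalent_enumRelator {P : GroupPresentation} (hP : P.IsRecursive) :
    ∃ c : Code, ∀ g : ℕ → Bool, g 0 → (∀ n ∈ P.gens, g n) →
      ComputablyEquivalent P.words P.WordProblem (ofEnum {n | g n} (enumRelator g c)).words
        (ofEnum {n | g n} (enumRelator g c)).WordProblem := by
  obtain ⟨hX, hR⟩ := hP
  have hW : REPred fun w => w ∈ P.spell '' P.rels ∨ ∃ n, n ∉ P.gens ∧ w = [(n, true)] := by
    obtain ⟨f, hf, hfX⟩ := ComputablePred.computable_iff.1 hX.not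
    obtain ⟨f', hf', hfR⟩ := ComputablePred.computable_iff.1 hR
    have hfX (n : ℕ) : n ∉ P.gens ↔ f n = true := iff_of_eq (congrFun hfX n)
    have hfR (w : List (ℕ × Bool)) : w ∈ P.spell '' P.rels ↔ f' w = true :=
      iff_of_eq (congrFun hfR w)
    have heq : Primrec fun t : List (ℕ × Bool) × ℕ => decide (t.1 = [(t.2, true)]) :=
      Primrec.eq.decide.comp Primrec.fst
        (Primrec.list_cons.comp (Primrec.snd.pair (Primrec.const true)) (Primrec.const []))
    refine (REPred.of_exists
      (R := fun t : List (ℕ × Bool) × ℕ =>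
        (f' t.1 || (f t.2 && decide (t.1 = [(t.2, true)]))) = true)
      (ComputablePred.computable_iff.2 ⟨_, Primrec.or.to_comp.comp (hf'.comp Computable.fst)
        (Primrec.and.to_comp.comp (hf.comp Computable.snd) heq.to_comp), rfl⟩)).of_eq fun w => ?_
    simp only [hfX, hfR, Bool.or_eq_true, Bool.and_eq_true, decide_eq_true_eq, exists_or,
      exists_const]
  obtain ⟨c, hc⟩ := hW.exists_code
  refine ⟨c, fun g hg₀ hg => ?_⟩
  have hone {w : List (ℕ × Bool)}
      (hw : w ∈ P.spell '' P.rels ∨ ∃ n, n ∉ P.gens ∧ w = [(n, true)]) (hwg : ∀ l ∈ w, g l.1) :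
      ambientValue (Set.range (enumRelator g c)) w = 1 := by
    obtain ⟨s, hs⟩ := (hc w).1 hw
    have ht : enumRelator g c (Nat.pair s (encode w)) = w ++ padding (Nat.pair s (encode w)) := by
      simp only [enumRelator, Nat.unpair_pair, wordOfCode_encode, hs, cond_true]
      rw [List.filter_eq_self.2 hwg]
    have := ambientValue_eq_one (R := Set.range (enumRelator g c)) ⟨_, ht⟩
    rwa [ambientValue, ← FreeGroup.mul_mk, mk_padding, mul_one] at this
  refine computablyEquivalent_ofEnum hX (fun n hn => hg n hn)
    (fun t l hl => mem_of_mem_enumRelator hg₀ hl) (fun r hr => ?_) (fun n hn hnP => ?_) fun t => ?_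
  · exact hone (.inl ⟨r, hr, rfl⟩) fun l hl => hg _ (mem_words_iff.1 (spell_mem_words r) l hl)
  · refine hone (.inr ⟨n, hnP, rfl⟩) fun l hl => ?_
    rw [List.mem_singleton.1 hl]
    exact hn
  · rw [enumRelator, ← FreeGroup.mul_mk, mk_padding, mul_one]
    cases h : haltsWithin c t.unpair.1 (encode (wordOfCode t.unpair.2))
    · exact map_one _
    · rw [cond_true, kill_filter hg]
      generalize wordOfCode t.unpair.2 = w at h
      rcases (hc w).2 ⟨_, h⟩ with ⟨r, hr, rfl⟩ | ⟨n, hn, rfl⟩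
      · exact (kill_spell r).trans (PresentedGroup.one_of_mem ⟨r, hr, rfl⟩)
      · exact kill_letter hn true

theorem wordProblemIndices_isFGRecursive :
    IsSigmaThreeComplete (wordProblemIndices IsFGRecursive) ∧
      IsCEProper (wordProblemIndices IsFGRecursive) := by
  have hgen : Primrec₂ fun (a : ℕ × Code) (n : ℕ) => decide (n ≤ a.1) :=
    Primrec.nat_le.decide.comp Primrec.snd (Primrec.fst.comp Primrec.fst)
  refine isSigmaThreeComplete_and_isCEProper hgen
    (primrec_enumRelator hgen Primrec.snd)
    (fun a t l hl => mem_of_mem_enumRelator (by simp) hl)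
    ⟨Set.finite_singleton 0, isRecursive_infiniteCyclic⟩ (fun a => ⟨?_, ?_⟩) fun P hP => ?_
  · exact (Set.finite_Iic a.1).subset fun n hn => of_decide_eq_true hn
  · exact isRecursive_ofEnum_enumRelator (hgen.comp (Primrec.const a) Primrec.id) (by simp) a.2
  · obtain ⟨k, hk⟩ := hP.1.bddAbove
    obtain ⟨c, hc⟩ := exists_computablyEquivalent_enumRelator hP.2
    exact ⟨(k, c), hc _ (by simp) fun n hn => decide_eq_true (hk hn)⟩

theorem wordProblemIndices_isRecursive :
    IsSigmaThreeComplete (wordProblemIndices IsRecursive) ∧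
      IsCEProper (wordProblemIndices IsRecursive) := by
  have hgen : Primrec₂ fun (_ : Code) (_ : ℕ) => true := Primrec.const true
  refine isSigmaThreeComplete_and_isCEProper hgen (primrec_enumRelator hgen Primrec.id)
    (fun a t l hl => mem_of_mem_enumRelator rfl hl) isRecursive_infiniteCyclic (fun a => ?_)
    fun P hP => ?_
  · exact isRecursive_ofEnum_enumRelator (Primrec.const true) rfl a
  · obtain ⟨c, hc⟩ := exists_computablyEquivalent_enumRelator hP
    exact ⟨c, hc _ rfl fun _ _ => rfl⟩

theorem mainTheorem3 :
    (IsSigmaThreeComplete (wordProblemIndices GroupPresentation.IsFinite) ∧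
      IsSigmaThreeComplete (wordProblemIndices GroupPresentation.IsFGRecursive) ∧
      IsSigmaThreeComplete (wordProblemIndices GroupPresentation.IsRecursive)) ∧
    (IsCEProper (wordProblemIndices GroupPresentation.IsFinite) ∧
      IsCEProper (wordProblemIndices GroupPresentation.IsFGRecursive) ∧
      IsCEProper (wordProblemIndices GroupPresentation.IsRecursive)) :=
  ⟨⟨wordProblemIndices_isFinite.1, wordProblemIndices_isFGRecursive.1,
    wordProblemIndices_isRecursive.1⟩, wordProblemIndices_isFinite.2,
    wordProblemIndices_isFGRecursive.2, wordProblemIndices_isRecursive.2⟩
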